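/- Let $p\ge 0$, $m\ge 1$, and let $G$ be a connected undirected graph on $[m]=\{1,\dots,m\}$ with weighted adjacency matrix $A\in\mathbb R^{m\times m}$: $A$ is symmetric, entrywise nonnegative and row stochastic, has positive diagonal entries, and for $i\ne j$ one has $A_{ij}>0$ exactly when $\{i,j\}$ is an edge of $G$. Let $\Theta\subseteq\mathbb R^p$ be open, let $\mu$ be a measure on a measurable space $\mathcal X$, let $h:\mathcal X\to[0,\infty)$ and $T^1,\dots,T^m:\mathcal X\to\mathbb R^p$ be measurable, and let $\psi^1,\dots,\psi^m$ be such that for all $\theta\in\Theta$ and $i\in[m]$ $$p^i_\theta(x)=h(x)\exp\big(\langle\theta,T^i(x)\rangle-\psi^i(\theta)\big)$$ is the $\mu$-density of a probability measure $\mathbf P^i_\theta$. Assume that each of these families is of full rank (for no $a\neq 0$ is $\langle a,T^i\rangle$ $\mathbf P^i_\theta$-almost surely constant), that the models are well specified, i.e. for some $\theta_0\in\Theta$ and a distribution $\mathbf P_0$ on $\mathcal X$ we have $\mathbf P_0=\mathbf P^i_{\theta_0}$ for every $i\in[m]$, and that $\mathbf P_0|\log p^i_\theta|<\infty$ for all $\theta\in\Theta$,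 $i\in[m]$. Let $\Pi$ be a prior probability measure on $\Theta$ with Lebesgue density $$\pi(\theta)=g\,\exp\big(\langle\theta,u\rangle-\psi^0(\theta)\big),\qquad g\in\mathbb R,\ u\in\mathbb R^p,$$ where $\psi^0$ is measurable on $\Theta$ and continuous at $\theta_0$. Let the observations $X^i_k$ (agent $i\in[m]$, time $k$) be independent with law $\mathbf P_0$, and for $t\ge1$, $j\in[m]$ let $P^j_t$ be the distributed Bayes posterior $$P^j_t(d\theta)=\frac1{z^j_t}\;p^j_\theta(X^j_t)\prod_{k=1}^{t-1}\prod_{i=1}^m p^i_\theta(X^i_k)^{[A^{t-k}]_{ij}}\;\Pi(d\theta),$$ with $z^j_t$ the normalizing constant. Put $$\chi^j_t=\sum_{k=1}^t\sum_{i=1}^m[A^{t-k}]_{ji}\,T^i(X^i_k),\qquad B^j_t(\theta)=\sum_{k=1}^t\sum_{i=1}^m[A^{t-k}]_{ji}\,\psi^i(\theta)\quad(\theta\in\Theta),$$ $\hat\theta^j_t=(\nabla B^j_t)^{-1}(\chi^j_t)$ (with an arbitrary value if $\chi_t^j\notin\nabla B_t^j(\Theta)$), and $V=\frac1m\sum_{i=1}^m\mathrm{Cov}(T^i)$,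 the covariance matrices being taken under $\mathbf P_0$. Then, for every $j\in[m]$: $V$ is positive definite; $\nabla B^j_t$ is injective on $\Theta$ for every $t\ge1$, and $\chi^j_t\in\nabla B^j_t(\Theta)$ with probability tending to $1$ as $t\to\infty$; almost surely $P^j_t$ is a probability measure for every $t\ge1$; and, if $q^j_t$ denotes the density of $\sqrt t\,(\theta-\hat\theta^j_t)$ when $\theta\sim P^j_t$, and $\phi$ the density of the normal distribution $N(0,V^{-1})$ on $\mathbb R^p$, $$\int_{\mathbb R^p}\big|q^j_t(x)-\phi(x)\big|\,dx\;\longrightarrow\;0\qquad\text{in probability as }t\to\infty.$$ -/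

import Mathlib

open MeasureTheory ProbabilityTheory Filter Topology
open scoped ENNReal RealInnerProductSpace

noncomputable section

namespace DistBayes

/-- The parameter space `ℝᵖ` and the space of values of the sufficient statistics. -/
abbrev E (p : ℕ) : Type := EuclideanSpace ℝ (Fin p)

/-! ### Communication graph -/

/-- `A` is the weighted adjacency matrix of the connected undirected graph `G`: it is symmetric,
row stochastic, has positive diagonal entries, and its positive off-diagonal entries are exactly
the edges of `G`. -/
structure IsCommunicationMatrix {m : ℕ} (G : SimpleGraph (Fin m))
    (A : Matrix (Fin m) (Fin m) ℝ) : Prop where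
  connected : G.Connected
  symm : A.IsSymm
  nonneg : ∀ i j, 0 ≤ A i j
  row_sum : ∀ i, ∑ j, A i j = 1
  diag_pos : ∀ i, 0 < A i i
  adj_iff : ∀ i j, i ≠ j → (0 < A i j ↔ G.Adj i j)

/-! ### Canonical exponential families -/

/-- The density `h(x) exp(⟨θ, T(x)⟩ - ψ(θ))`. -/
def efDensity {p : ℕ} {𝒳 : Type*} (h : 𝒳 → ℝ) (T : 𝒳 → E p) (ψ : E p → ℝ) (θ : E p) (x : 𝒳) : ℝ :=
  h x * Real.exp (⟪θ, T x⟫ - ψ θ)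

/-- The measure with density `h(x) exp(⟨θ, T(x)⟩ - ψ(θ))` with respect to `μ`. -/
def efMeasure {p : ℕ} {𝒳 : Type*} [MeasurableSpace 𝒳] (μ : Measure 𝒳) (h : 𝒳 → ℝ) (T : 𝒳 → E p)
    (ψ : E p → ℝ) (θ : E p) : Measure 𝒳 :=
  μ.withDensity fun x => ENNReal.ofReal (efDensity h T ψ θ x)

/-- `{efMeasure μ h T ψ θ : θ ∈ Θ}` is a canonical exponential family with sufficient statistic
`T` and log-partition function `ψ` (on `Θ`, where normalization determines `ψ`). -/
structure IsCanonicalExpFamily {p : ℕ} {𝒳 : Type*} [MeasurableSpace 𝒳] (μ : Measure 𝒳)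
    (Θ : Set (E p)) (h : 𝒳 → ℝ) (T : 𝒳 → E p) (ψ : E p → ℝ) : Prop where
  measurable_h : Measurable h
  h_nonneg : ∀ x, 0 ≤ h x
  measurable_T : Measurable T
  normalized : ∀ θ ∈ Θ, IsProbabilityMeasure (efMeasure μ h T ψ θ)

/-- The family is of full rank: under no member of the family is a nontrivial linear combination
of the coordinates of `T` almost surely constant. -/
def IsFullRank {p : ℕ} {𝒳 : Type*} [MeasurableSpace 𝒳] (μ : Measure 𝒳)
    (Θ : Set (E p)) (h : 𝒳 → ℝ) (T : 𝒳 → E p) (ψ : E p → ℝ) : Prop :=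
  ∀ θ ∈ Θ, ∀ a : E p, a ≠ 0 → ∀ c : ℝ, ¬ ∀ᵐ x ∂(efMeasure μ h T ψ θ), ⟪a, T x⟫ = c

/-- The prior on `Θ` with Lebesgue density `g exp(⟨θ, u⟩ - ψ⁰(θ))`. -/
def efPrior {p : ℕ} (Θ : Set (E p)) (g : ℝ) (u : E p) (ψ0 : E p → ℝ) : Measure (E p) :=
  (volume.restrict Θ).withDensity fun θ => ENNReal.ofReal (g * Real.exp (⟪θ, u⟫ - ψ0 θ))

/-! ### The distributed Bayes posterior -/

/-- Surrogate likelihood of agent `j` at time `t` for private densities `dens i θ x` and data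
`x k i` (observation of agent `i` at time `k`, `k = 1, 2, …`) on a static network:
`p_θ^j(x_t^j) ∏_{k=1}^{t-1} ∏_i p_θ^i(x_k^i) ^ [A^{t-k}]_{ij}`. -/
def surrogateLikelihood {p m : ℕ} {𝒳 : Type*} (A : Matrix (Fin m) (Fin m) ℝ)
    (dens : Fin m → E p → 𝒳 → ℝ) (x : ℕ → Fin m → 𝒳) (t : ℕ) (j : Fin m) (θ : E p) : ℝ :=
  dens j θ (x t j) *
    ∏ k ∈ Finset.Icc 1 (t - 1), ∏ i : Fin m, dens i θ (x k i) ^ ((A ^ (t - k)) i j)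

/-- The normalizing constant `z_t^j` of the distributed Bayes posterior. -/
def evidence {p m : ℕ} {𝒳 : Type*} (A : Matrix (Fin m) (Fin m) ℝ)
    (dens : Fin m → E p → 𝒳 → ℝ) (prior : Measure (E p)) (x : ℕ → Fin m → 𝒳) (t : ℕ)
    (j : Fin m) : ℝ≥0∞ :=
  ∫⁻ θ, ENNReal.ofReal (surrogateLikelihood A dens x t j θ) ∂prior

/-- The distributed Bayes posterior `P_t^j`. -/
def posterior {p m : ℕ} {𝒳 : Type*} (A : Matrix (Fin m) (Fin m) ℝ)
    (dens : Fin m → E p → 𝒳 → ℝ) (prior : Measure (E p)) (x : ℕ → Fin m → 𝒳) (t : ℕ)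
    (j : Fin m) : Measure (E p) :=
  (evidence A dens prior x t j)⁻¹ •
    prior.withDensity fun θ => ENNReal.ofReal (surrogateLikelihood A dens x t j θ)

/-! ### The estimator -/

/-- `χ_t^j = ∑_{k=1}^t ∑_i [A^{t-k}]_{ji} T^i(x_k^i)`. -/
def chi {p m : ℕ} {𝒳 : Type*} (A : Matrix (Fin m) (Fin m) ℝ) (T : Fin m → 𝒳 → E p)
    (x : ℕ → Fin m → 𝒳) (t : ℕ) (j : Fin m) : E p :=
  ∑ k ∈ Finset.Icc 1 t, ∑ i : Fin m, (A ^ (t - k)) j i • T i (x k i)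

/-- `B_t^j(θ) = ∑_{k=1}^t ∑_i [A^{t-k}]_{ji} ψ^i(θ)`. -/
def logPartition {p m : ℕ} (A : Matrix (Fin m) (Fin m) ℝ) (ψ : Fin m → E p → ℝ)
    (t : ℕ) (j : Fin m) (θ : E p) : ℝ :=
  ∑ k ∈ Finset.Icc 1 t, ∑ i : Fin m, (A ^ (t - k)) j i * ψ i θ

/-- `θ̂_t^j = (∇ B_t^j)⁻¹(χ_t^j)`, where `∇ B_t^j` is a map on `Θ`; it takes an arbitrary value
when `χ_t^j` is not in the range of `∇ B_t^j`. -/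
def estimator {p m : ℕ} {𝒳 : Type*} (Θ : Set (E p)) (A : Matrix (Fin m) (Fin m) ℝ)
    (T : Fin m → 𝒳 → E p) (ψ : Fin m → E p → ℝ) (x : ℕ → Fin m → 𝒳) (t : ℕ) (j : Fin m) : E p :=
  Function.invFunOn (gradient (logPartition A ψ t j)) Θ (chi A T x t j)

/-! ### The limit -/

/-- `V = (1/m) ∑_i Cov(T^i)`, the covariances being taken under `P0`. -/
def avgCov {p m : ℕ} {𝒳 : Type*} [MeasurableSpace 𝒳] (P0 : Measure 𝒳) (T : Fin m → 𝒳 → E p) :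
    Matrix (Fin p) (Fin p) ℝ :=
  Matrix.of fun a b => (1 / (m : ℝ)) * ∑ i : Fin m, cov[fun x => T i x a, fun x => T i x b; P0]

/-- The Lebesgue density of the centred normal distribution on `ℝᵖ` with (positive definite)
covariance matrix `S`. -/
def gaussianDensity {p : ℕ} (S : Matrix (Fin p) (Fin p) ℝ) (x : E p) : ℝ :=
  Real.exp (-(1 / 2) * (x.ofLp ⬝ᵥ (S⁻¹.mulVec x.ofLp))) / Real.sqrt ((2 * Real.pi) ^ p * S.det)

/-- The Lebesgue density of `√t (θ - c)` when `θ ∼ P`. -/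
def rescaledDensity {p : ℕ} (P : Measure (E p)) (c : E p) (t : ℕ) : E p → ℝ≥0∞ :=
  (P.map fun θ => Real.sqrt t • (θ - c)).rnDeriv volume

end DistBayes

end

noncomputable section

namespace DistBayes

/-! Up to a factor free of θ, the surrogate likelihood is exp(⟨θ, χ⟩ - B_t(θ)), so given t the
posterior depends on the data only through χ (`exists_surrogateLikelihood_eq`, `posterior_eq`). The
problem splits into a deterministic Laplace approximation for pairs (t, χ) and a weak law of large
numbers for χ. They meet in `dataFilter`, along which the normalized score (χ - ∇B_t(θ0)) / t
vanishes.

Deterministic side. Each ψ^i has the mean of T^i as gradient and lies strictly above its tangents,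
by full rank. Strict differentiability of the mean map at θ0 gives a second-order expansion with
Hessian Cov(T^i), uniform in both points (`exists_expansion`). Now B_t is a combination of the ψ^i
with weights ∑_{s<t} [A^s]_{ji}, and these weights divided by t tend to 1/m by the mean ergodic
theorem: A is a contraction whose fixed vectors are the constants. So B_t / t is uniformly quadratic
near θ0, with limiting form V (`isLocallyQuadratic_logPartition`). When χ = ∇B_t(c), the
log-likelihood relative to c is exactly minus the divergence of B_t from c. At c + x/√t this tends
to -⟨x, Vx⟩/2. Quadratic growth near θ0 dominates the inner part, and growth linear in t at fixed
distance kills the outer part, giving L¹ convergence of the kernels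
(`tendsto_lintegral_posteriorKernel`). Normalization preserves it
(`lintegral_abs_normalized_sub_le`).

Probabilistic side. The mean of χ is ∇B_t(θ0), and since the weights lie in [0, 1], Chebyshev's
inequality shows that whatever holds eventually along `dataFilter` has probability tending to one
(`tendsto_measure_not_of_eventually_dataFilter`). Finiteness of the normalizing constant follows
from Tonelli's theorem, because the expected likelihood ratio is at most one
(`lintegral_exp_le_one`). -/

/-! ### Exponential families relative to one of their members -/

/-- `P` is the member with parameter `θ0` of a family of full rank whose other members are the
exponential tiltings `exp(⟨θ - θ0, T⟩ - (ψ θ - ψ θ0)) P`, for `θ` in the open set `Θ`. -/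
structure IsTiltedFamily {p : ℕ} {𝒳 : Type*} [MeasurableSpace 𝒳] (P : Measure 𝒳)
    (Θ : Set (E p)) (θ0 : E p) (T : 𝒳 → E p) (ψ : E p → ℝ) : Prop where
  isProb : IsProbabilityMeasure P
  isOpen : IsOpen Θ
  mem : θ0 ∈ Θ
  measurable_T : Measurable T
  integrable : ∀ θ ∈ Θ, Integrable (fun x => Real.exp ⟪θ - θ0, T x⟫) P
  integral : ∀ θ ∈ Θ, ∫ x, Real.exp ⟪θ - θ0, T x⟫ ∂P = Real.exp (ψ θ - ψ θ0)
  not_const : ∀ a : E p, a ≠ 0 → ∀ c : ℝ, ¬ ∀ᵐ x ∂P, ⟪a, T x⟫ = c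

/-- `f` is integrable, with some room in the exponent, under all tiltings of `P`. -/
structure HasExpMoments {p : ℕ} {𝒳 F : Type*} [MeasurableSpace 𝒳] [NormedAddCommGroup F]
    (P : Measure 𝒳) (Θ : Set (E p)) (θ0 : E p) (T : 𝒳 → E p) (f : 𝒳 → F) : Prop where
  aesm : AEStronglyMeasurable f P
  exists_integrable : ∀ θ ∈ Θ, ∃ ε > 0,
    Integrable (fun x => Real.exp (⟪θ - θ0, T x⟫ + ε * ‖T x‖) * ‖f x‖) P

/-- The norm is at most p times the largest |x k|, and the exponential of an absolute value is at
most the sum over both signs. This bounds an exponential moment of ‖T‖ by finitely many tiltings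
along coordinate directions. -/
lemma exp_mul_norm_le {p : ℕ} {c : ℝ} (hc : 0 ≤ c) (x : E p) :
    Real.exp (c * ‖x‖) ≤ 1 + ∑ k : Fin p, (Real.exp (⟪(c * p) • EuclideanSpace.single k 1, x⟫)
      + Real.exp (⟪(-(c * p)) • EuclideanSpace.single k 1, x⟫)) := by
  simp only [inner_smul_left, EuclideanSpace.inner_single_left, map_one, one_mul,
    conj_trivial]
  rcases isEmpty_or_nonempty (Fin p) with hp | hp
  · have : ‖x‖ = 0 := by simp [EuclideanSpace.norm_eq]
    simp [this]
  obtain ⟨k, hk⟩ := Finite.exists_max fun k => |x k|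
  have h1 : ‖x‖ ≤ p * |x k| := by
    have hp1 : (1 : ℝ) ≤ p := by
      have : 0 < p := Fin.pos k
      exact_mod_cast this
    refine abs_le_of_sq_le_sq' ?_ (by positivity) |>.2
    rw [EuclideanSpace.norm_sq_eq]
    calc ∑ i, ‖x i‖ ^ 2 ≤ ∑ _i : Fin p, |x k| ^ 2 :=
          Finset.sum_le_sum fun i _ => by rw [Real.norm_eq_abs]; exact pow_le_pow_left₀ (abs_nonneg _) (hk i) 2
      _ = p * |x k| ^ 2 := by simp
      _ ≤ (p * |x k|) ^ 2 := by rw [mul_pow]; gcongr; nlinarith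
  have h2 : Real.exp (c * ‖x‖) ≤ Real.exp (c * p * x k) + Real.exp (-(c * p) * x k) := by
    have h3 : c * ‖x‖ ≤ c * p * |x k| := by rw [mul_assoc]; gcongr
    rcases abs_cases (x k) with ⟨h, _⟩ | ⟨h, _⟩ <;> rw [h] at h3
    · exact (Real.exp_le_exp.2 h3).trans (le_add_of_nonneg_right (Real.exp_nonneg _))
    · exact (Real.exp_le_exp.2 (by linarith)).trans (le_add_of_nonneg_left (Real.exp_nonneg _))
  have h4 := Finset.single_le_sum (f := fun k => Real.exp (c * p * x k) + Real.exp (-(c * p) * x k))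
    (fun i _ => by positivity) (Finset.mem_univ k)
  linarith

/-- The kernel of the derivative of `θ ↦ ∫ exp⟨θ - θ0, T⟩ f`. -/
def tiltDeriv {p : ℕ} {𝒳 F : Type*} [NormedAddCommGroup F] [NormedSpace ℝ F]
    (T : 𝒳 → E p) (f : 𝒳 → F) (x : 𝒳) : E p →L[ℝ] F :=
  (innerSL ℝ (T x)).smulRight (f x)

lemma norm_tiltDeriv {p : ℕ} {𝒳 F : Type*} [NormedAddCommGroup F] [NormedSpace ℝ F]
    {T : 𝒳 → E p} {f : 𝒳 → F} (x : 𝒳) : ‖tiltDeriv T f x‖ = ‖T x‖ * ‖f x‖ := by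
  rw [tiltDeriv, ContinuousLinearMap.norm_smulRight_apply, innerSL_apply_norm]

section moments

variable {p : ℕ} {𝒳 F : Type*} [MeasurableSpace 𝒳] [NormedAddCommGroup F]
  {P : Measure 𝒳} {Θ : Set (E p)} {θ0 : E p} {T : 𝒳 → E p} {ψ : E p → ℝ} {f : 𝒳 → F}

/-- The room in the exponent comes from openness of Θ: by `exp_mul_norm_le` it costs only the
tiltings at θ shifted along ± each coordinate, which stay in Θ for small shifts. -/
lemma IsTiltedFamily.hasExpMoments_one (hT : IsTiltedFamily P Θ θ0 T ψ) :
    HasExpMoments P Θ θ0 T (fun _ => (1 : ℝ)) := by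
  refine ⟨aestronglyMeasurable_const, fun θ hθ => ?_⟩
  obtain ⟨r, hr, hball⟩ := Metric.isOpen_iff.1 hT.isOpen θ hθ
  -- The shifts have length ε p, which must be below r; the `+ 1` avoids division by zero when p =
  -- 0.
  set ε := r / (2 * (p + 1)) with hε
  have hε0 : 0 < ε := by positivity
  have hεp : ε * p < r := by
    rw [hε, div_mul_eq_mul_div, div_lt_iff₀ (by positivity)]; nlinarith [(Nat.cast_nonneg p : (0:ℝ) ≤ p)]
  have hmem : ∀ (k : Fin p) (s : ℝ), |s| = ε * p → θ + s • EuclideanSpace.single k 1 ∈ Θ := by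
    intro k s hs
    apply hball
    rw [Metric.mem_ball, dist_eq_norm, add_sub_cancel_left, norm_smul, PiLp.norm_single,
      Real.norm_eq_abs, hs]
    simpa using hεp
  have hp0 : 0 ≤ ε * p := by positivity
  refine ⟨ε, hε0, ?_⟩
  have hint : Integrable (fun x => Real.exp ⟪θ - θ0, T x⟫ + ∑ k : Fin p,
      (Real.exp ⟪θ + (ε * p) • EuclideanSpace.single k 1 - θ0, T x⟫
        + Real.exp ⟪θ + (-(ε * p)) • EuclideanSpace.single k 1 - θ0, T x⟫)) P := by
    refine (hT.integrable θ hθ).add (integrable_finsetSum _ fun k _ => ?_)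
    exact (hT.integrable _ (hmem k _ (abs_of_nonneg hp0))).add
      (hT.integrable _ (hmem k _ (by rw [abs_neg, abs_of_nonneg hp0])))
  have hmeas := hT.measurable_T
  refine hint.mono' (by fun_prop) (ae_of_all _ fun x => ?_)
  rw [Real.norm_eq_abs, abs_of_nonneg (by positivity), norm_one, mul_one, Real.exp_add]
  calc Real.exp ⟪θ - θ0, T x⟫ * Real.exp (ε * ‖T x‖) ≤ _ :=
        mul_le_mul_of_nonneg_left (exp_mul_norm_le hε0.le (T x)) (Real.exp_nonneg _)
    _ = _ := by
        rw [mul_add, mul_one, Finset.mul_sum]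
        congr 1
        refine Finset.sum_congr rfl fun k _ => ?_
        rw [mul_add, ← Real.exp_add, ← Real.exp_add, ← inner_add_left, ← inner_add_left]
        congr 3 <;> abel

/-- Half of the room ε is spent on absorbing the factor ‖T x‖ into exp(ε/2 ‖T x‖). Iterating this
gives all polynomial moments, hence repeated differentiability. -/
lemma HasExpMoments.of_norm_le {F' : Type*} [NormedAddCommGroup F'] {f' : 𝒳 → F'}
    (hf : HasExpMoments P Θ θ0 T f) (hT : Measurable T) (hf' : AEStronglyMeasurable f' P)
    (h : ∀ x, ‖f' x‖ ≤ ‖T x‖ * ‖f x‖) :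
    HasExpMoments P Θ θ0 T f' := by
  refine ⟨hf', fun θ hθ => ?_⟩
  obtain ⟨ε, hε, hi⟩ := hf.exists_integrable θ hθ
  refine ⟨ε / 2, by positivity, (hi.const_mul (2 / ε)).mono' ?_ (ae_of_all _ fun x => ?_)⟩
  · exact (AEMeasurable.aestronglyMeasurable (by fun_prop)).mul hf'.norm
  · rw [Real.norm_eq_abs, abs_of_nonneg (by positivity)]
    have h1 : ‖T x‖ ≤ 2 / ε * Real.exp (ε / 2 * ‖T x‖) := by
      have := Real.add_one_le_exp (ε / 2 * ‖T x‖)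
      rw [div_mul_eq_mul_div, le_div_iff₀ hε]
      linarith
    have h2 : ⟪θ - θ0, T x⟫ + ε * ‖T x‖
        = (⟪θ - θ0, T x⟫ + ε / 2 * ‖T x‖) + ε / 2 * ‖T x‖ := by ring
    rw [h2, Real.exp_add (_ + _)]
    calc _ ≤ Real.exp (⟪θ - θ0, T x⟫ + ε / 2 * ‖T x‖) *
            ((2 / ε * Real.exp (ε / 2 * ‖T x‖)) * ‖f x‖) := by
          gcongr
          exact (h x).trans (by gcongr)
      _ = _ := by ring

variable [NormedSpace ℝ F]

lemma aestronglyMeasurable_tiltDeriv (hT : Measurable T) (hf : AEStronglyMeasurable f P) :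
    AEStronglyMeasurable (tiltDeriv T f) P := by
  have h1 : AEStronglyMeasurable (fun x => innerSL ℝ (T x)) P :=
    (innerSL ℝ).continuous.comp_aestronglyMeasurable hT.aestronglyMeasurable
  exact (ContinuousLinearMap.smulRightL ℝ (E p) F).aestronglyMeasurable_comp₂ h1 hf

lemma HasExpMoments.tiltDeriv (hf : HasExpMoments P Θ θ0 T f) (hT : Measurable T) :
    HasExpMoments P Θ θ0 T (tiltDeriv T f) :=
  hf.of_norm_le hT (aestronglyMeasurable_tiltDeriv hT hf.aesm) fun x => (norm_tiltDeriv x).le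

lemma HasExpMoments.integrable (hf : HasExpMoments P Θ θ0 T f) (hT : Measurable T)
    {θ : E p} (hθ : θ ∈ Θ) : Integrable (fun x => Real.exp ⟪θ - θ0, T x⟫ • f x) P := by
  obtain ⟨ε, hε, hi⟩ := hf.exists_integrable θ hθ
  refine hi.mono' ((AEMeasurable.aestronglyMeasurable (by fun_prop)).smul hf.aesm)
    (ae_of_all _ fun x => ?_)
  rw [norm_smul, Real.norm_eq_abs, Real.abs_exp]
  gcongr
  have : 0 ≤ ε * ‖T x‖ := by positivity
  linarith

/-- Differentiation under the integral sign in an exponential family. -/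
lemma HasExpMoments.hasFDerivAt_integral (hf : HasExpMoments P Θ θ0 T f) (hT : Measurable T)
    {θ : E p} (hθ : θ ∈ Θ) :
    HasFDerivAt (fun η => ∫ x, Real.exp ⟪η - θ0, T x⟫ • f x ∂P)
      (∫ x, Real.exp ⟪θ - θ0, T x⟫ • DistBayes.tiltDeriv T f x ∂P) θ := by
  -- For ‖η - θ‖ < ε, Cauchy–Schwarz bounds exp⟨η - θ, T⟩ by exp(ε ‖T‖), so ε serves as the radius
  -- of the ball and `hi` supplies the dominating function.
  obtain ⟨ε, hε, hi⟩ := (hf.tiltDeriv hT).exists_integrable θ hθ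
  have hm : ∀ η : E p, AEStronglyMeasurable (fun x => Real.exp ⟪η - θ0, T x⟫) P := fun η =>
    AEMeasurable.aestronglyMeasurable (by fun_prop)
  refine hasFDerivAt_integral_of_dominated_of_fderiv_le
    (F' := fun η x => Real.exp ⟪η - θ0, T x⟫ • DistBayes.tiltDeriv T f x)
    (Metric.ball_mem_nhds θ hε) (Eventually.of_forall fun η => (hm η).smul hf.aesm)
    (hf.integrable hT hθ)
    ((hm θ).smul (aestronglyMeasurable_tiltDeriv hT hf.aesm))
    (ae_of_all _ fun x η hη => ?_) hi (ae_of_all _ fun x η hη => ?_)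
  · rw [norm_smul, Real.norm_eq_abs, Real.abs_exp]
    gcongr
    rw [Metric.mem_ball, dist_eq_norm] at hη
    have h1 : ⟪η - θ0, T x⟫ = ⟪θ - θ0, T x⟫ + ⟪η - θ, T x⟫ := by
      rw [← inner_add_left]; congr 1; abel
    have h2 : ⟪η - θ, T x⟫ ≤ ε * ‖T x‖ :=
      (real_inner_le_norm _ _).trans (by gcongr)
    linarith
  · have h1 : HasFDerivAt (fun η : E p => ⟪η - θ0, T x⟫) (innerSL ℝ (T x)) η := by
      refine ((innerSL ℝ (T x)).hasFDerivAt.sub_const ⟪θ0, T x⟫).congr_of_eventuallyEq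
        (Eventually.of_forall fun y => ?_)
      simp only [innerSL_apply_apply]
      rw [inner_sub_left, real_inner_comm y]
    convert h1.exp.smul_const (f x) using 1
    ext v
    simp [DistBayes.tiltDeriv, smul_smul]

lemma HasExpMoments.continuousOn_integral (hf : HasExpMoments P Θ θ0 T f) (hT : Measurable T) :
    ContinuousOn (fun η => ∫ x, Real.exp ⟪η - θ0, T x⟫ • f x ∂P) Θ := fun _ hθ =>
  (hf.hasFDerivAt_integral hT hθ).continuousAt.continuousWithinAt

/-- The derivative is an integral of the same shape with kernel `tiltDeriv T f`, hence continuous on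
Θ. Strictness is what later makes the second-order expansion uniform in both points. -/
lemma HasExpMoments.hasStrictFDerivAt_integral (hf : HasExpMoments P Θ θ0 T f)
    (hT : Measurable T) (hΘ : IsOpen Θ) {θ : E p} (hθ : θ ∈ Θ) :
    HasStrictFDerivAt (fun η => ∫ x, Real.exp ⟪η - θ0, T x⟫ • f x ∂P)
      (∫ x, Real.exp ⟪θ - θ0, T x⟫ • DistBayes.tiltDeriv T f x ∂P) θ := by
  have hn : ∀ᶠ y in 𝓝 θ, y ∈ Θ := hΘ.mem_nhds hθ
  exact hasStrictFDerivAt_of_hasFDerivAt_of_continuousAt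
    (hn.mono fun y hy => hf.hasFDerivAt_integral hT hy)
    (((hf.tiltDeriv hT).continuousOn_integral hT).continuousAt hn)

end moments

/-! ### Mean map, strict convexity and covariance of an exponential family -/

/-- The mean of the sufficient statistic under the tilting of `P` with parameter `θ`. -/
def tiltMean {p : ℕ} {𝒳 : Type*} [MeasurableSpace 𝒳] (P : Measure 𝒳) (θ0 : E p) (T : 𝒳 → E p)
    (θ : E p) : E p :=
  (∫ x, Real.exp ⟪θ - θ0, T x⟫ • (1 : ℝ) ∂P)⁻¹ • ∫ x, Real.exp ⟪θ - θ0, T x⟫ • T x ∂P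

namespace IsTiltedFamily

variable {p : ℕ} {𝒳 : Type*} [MeasurableSpace 𝒳] {P : Measure 𝒳} {Θ : Set (E p)} {θ0 : E p}
  {T : 𝒳 → E p} {ψ : E p → ℝ}

lemma integral_smul_one (hT : IsTiltedFamily P Θ θ0 T ψ) {θ : E p} (hθ : θ ∈ Θ) :
    ∫ x, Real.exp ⟪θ - θ0, T x⟫ • (1 : ℝ) ∂P = Real.exp (ψ θ - ψ θ0) := by
  simpa using hT.integral θ hθ

lemma hasExpMoments_id (hT : IsTiltedFamily P Θ θ0 T ψ) : HasExpMoments P Θ θ0 T T :=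
  hT.hasExpMoments_one.of_norm_le hT.measurable_T hT.measurable_T.aestronglyMeasurable
    fun x => by simp

/-- On Θ, ψ is a constant plus the logarithm of the integral of exp⟨θ - θ0, T⟩, so its gradient is
the logarithmic derivative. -/
lemma hasGradientAt (hT : IsTiltedFamily P Θ θ0 T ψ) {θ : E p} (hθ : θ ∈ Θ) :
    HasGradientAt ψ (tiltMean P θ0 T θ) θ := by
  have h1 := hT.hasExpMoments_one.hasFDerivAt_integral hT.measurable_T hθ
  have hne : ∫ x, Real.exp ⟪θ - θ0, T x⟫ • (1 : ℝ) ∂P ≠ 0 := by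
    rw [hT.integral_smul_one hθ]; exact (Real.exp_pos _).ne'
  have h2 := (h1.log hne).const_add (ψ θ0)
  rw [hasGradientAt_iff_hasFDerivAt]
  refine (h2.congr_of_eventuallyEq ?_).congr_fderiv ?_
  · filter_upwards [hT.isOpen.mem_nhds hθ] with η hη
    rw [hT.integral_smul_one hη, Real.log_exp]; ring
  · ext v
    rw [smul_apply, ContinuousLinearMap.integral_apply, tiltMean,
      InnerProductSpace.toDual_apply_apply, inner_smul_left, smul_eq_mul, real_inner_comm,
      ← integral_inner]
    · simp [tiltDeriv, inner_smul_right, real_inner_comm]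
    · exact hT.hasExpMoments_id.integrable hT.measurable_T hθ
    · exact (hT.hasExpMoments_one.tiltDeriv hT.measurable_T).integrable hT.measurable_T hθ

/-- The log-partition function lies strictly above its tangents. -/
lemma tangent_lt (hT : IsTiltedFamily P Θ θ0 T ψ) {a b : E p} (ha : a ∈ Θ) (hb : b ∈ Θ)
    (hab : a ≠ b) : ψ a + ⟪tiltMean P θ0 T a, b - a⟫ < ψ b := by
  have := hT.isProb
  -- Y is the log-likelihood ratio of b to a. Integrating exp Y - 1 - Y ≥ 0 under the member a is
  -- positivity of the Kullback–Leibler divergence, which here is the gap to the tangent.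
  set Y : 𝒳 → ℝ := fun x => ⟪b - a, T x⟫ - (ψ b - ψ a) with hY
  have iT := hT.hasExpMoments_id.integrable hT.measurable_T ha
  have ia := hT.integrable a ha
  have ib := hT.integrable b hb
  have e1 : ∀ x, Real.exp ⟪a - θ0, T x⟫ * Real.exp (Y x)
      = Real.exp (-(ψ b - ψ a)) * Real.exp ⟪b - θ0, T x⟫ := fun x => by
    rw [← Real.exp_add, ← Real.exp_add, hY]
    congr 1
    simp only [inner_sub_left]
    ring
  have e2 : ∀ x, Real.exp ⟪a - θ0, T x⟫ * Y x
      = ⟪b - a, Real.exp ⟪a - θ0, T x⟫ • T x⟫ - (ψ b - ψ a) * Real.exp ⟪a - θ0, T x⟫ := fun x => by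
    rw [inner_smul_right, hY]; ring
  have i1 : Integrable (fun x => Real.exp ⟪a - θ0, T x⟫ * Real.exp (Y x)) P := by
    simp only [e1]; exact ib.const_mul _
  have i2' : Integrable (fun x => ⟪b - a, Real.exp ⟪a - θ0, T x⟫ • T x⟫) P := iT.const_inner _
  have i2 : Integrable (fun x => Real.exp ⟪a - θ0, T x⟫ * Y x) P := by
    simp only [e2]; exact i2'.sub (ia.const_mul _)
  have v1 : ∫ x, Real.exp ⟪a - θ0, T x⟫ * Real.exp (Y x) ∂P = Real.exp (ψ a - ψ θ0) := by
    simp only [e1]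
    rw [integral_const_mul, hT.integral b hb, ← Real.exp_add]; congr 1; ring
  have v2 : ∫ x, Real.exp ⟪a - θ0, T x⟫ * Y x ∂P
      = Real.exp (ψ a - ψ θ0) * (⟪b - a, tiltMean P θ0 T a⟫ - (ψ b - ψ a)) := by
    simp only [e2]
    rw [integral_sub i2' (ia.const_mul _), integral_const_mul, hT.integral a ha,
      integral_inner iT, tiltMean, hT.integral_smul_one ha, inner_smul_right, mul_sub,
      mul_inv_cancel_left₀ (Real.exp_pos _).ne', mul_comm (ψ b - ψ a)]
  have hpos : 0 < ∫ x, Real.exp ⟪a - θ0, T x⟫ * (Real.exp (Y x) - 1 - Y x) ∂P := by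
    have hnn : ∀ x, 0 ≤ Real.exp ⟪a - θ0, T x⟫ * (Real.exp (Y x) - 1 - Y x) := fun x =>
      mul_nonneg (Real.exp_nonneg _) (by linarith [Real.add_one_le_exp (Y x)])
    refine lt_of_le_of_ne (integral_nonneg hnn) fun h0 => ?_
    have hI : Integrable (fun x => Real.exp ⟪a - θ0, T x⟫ * (Real.exp (Y x) - 1 - Y x)) P := by
      refine ((i1.sub ia).sub i2).congr (ae_of_all _ fun x => ?_)
      simp only [Pi.sub_apply]; ring
    have := (integral_eq_zero_iff_of_nonneg hnn hI).1 h0.symm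
    -- Equality forces Y = 0 almost surely, so ⟨b - a, T⟩ would be constant.
    refine hT.not_const (b - a) (sub_ne_zero.2 hab.symm) (ψ b - ψ a) ?_
    filter_upwards [this] with x hx
    by_contra hne
    have : Y x ≠ 0 := fun h => hne (by simpa [hY, sub_eq_zero] using h)
    have h3 := Real.add_one_lt_exp this
    have h4 : 0 < Real.exp ⟪a - θ0, T x⟫ * (Real.exp (Y x) - 1 - Y x) :=
      mul_pos (Real.exp_pos _) (by linarith)
    exact h4.ne' hx
  have e3 : ∫ x, Real.exp ⟪a - θ0, T x⟫ * (Real.exp (Y x) - 1 - Y x) ∂P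
      = Real.exp (ψ a - ψ θ0) * ((ψ b - ψ a) - ⟪b - a, tiltMean P θ0 T a⟫) := by
    have : ∀ x, Real.exp ⟪a - θ0, T x⟫ * (Real.exp (Y x) - 1 - Y x)
      = Real.exp ⟪a - θ0, T x⟫ * Real.exp (Y x) - Real.exp ⟪a - θ0, T x⟫
        - Real.exp ⟪a - θ0, T x⟫ * Y x := fun x => by ring
    have i12 : Integrable (fun x => Real.exp ⟪a - θ0, T x⟫ * Real.exp (Y x)
      - Real.exp ⟪a - θ0, T x⟫) P := i1.sub ia
    simp only [this]
    rw [integral_sub i12 i2, integral_sub i1 ia, v1, v2, hT.integral a ha]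
    ring
  rw [e3] at hpos
  have := pos_of_mul_pos_right hpos (Real.exp_nonneg _)
  rw [real_inner_comm]
  linarith

/-- At θ0 the tilting factor is one, and the kernel `tiltDeriv T T` has norm ‖T‖². -/
lemma memLp_two (hT : IsTiltedFamily P Θ θ0 T ψ) : MemLp T 2 P := by
  have h := (hT.hasExpMoments_id.tiltDeriv hT.measurable_T).integrable hT.measurable_T hT.mem
  rw [memLp_two_iff_integrable_sq_norm hT.measurable_T.aestronglyMeasurable]
  refine h.norm.congr (ae_of_all _ fun x => ?_)
  simp [norm_tiltDeriv, sq]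

lemma memLp_inner (hT : IsTiltedFamily P Θ θ0 T ψ) (v : E p) :
    MemLp (fun x => ⟪v, T x⟫) 2 P :=
  hT.memLp_two.const_inner v

lemma tiltMean_self (hT : IsTiltedFamily P Θ θ0 T ψ) :
    tiltMean P θ0 T θ0 = ∫ x, T x ∂P := by
  have := hT.isProb
  simp [tiltMean]

/-- The derivative of the mean map is the covariance operator. -/
lemma exists_hasStrictFDerivAt_tiltMean (hT : IsTiltedFamily P Θ θ0 T ψ) :
    ∃ H : E p →L[ℝ] E p, HasStrictFDerivAt (tiltMean P θ0 T) H θ0 ∧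
      ∀ v w : E p, ⟪v, H w⟫ = cov[fun x => ⟪v, T x⟫, fun x => ⟪w, T x⟫; P] := by
  have := hT.isProb
  have m1 := hT.hasExpMoments_one.tiltDeriv hT.measurable_T
  have mT := hT.hasExpMoments_id.tiltDeriv hT.measurable_T
  have d1 := hT.hasExpMoments_one.hasStrictFDerivAt_integral hT.measurable_T hT.isOpen hT.mem
  have dT := hT.hasExpMoments_id.hasStrictFDerivAt_integral hT.measurable_T hT.isOpen hT.mem
  have i1 := m1.integrable hT.measurable_T hT.mem
  have iT := mT.integrable hT.measurable_T hT.mem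
  have iT0 := hT.hasExpMoments_id.integrable hT.measurable_T hT.mem
  have hne : ∫ x, Real.exp ⟪θ0 - θ0, T x⟫ • (1 : ℝ) ∂P ≠ 0 := by
    rw [hT.integral_smul_one hT.mem]; exact (Real.exp_pos _).ne'
  -- Quotient rule. The denominator equals one at θ0, which leaves E[T⟨w, T⟩] - E[T] E⟨w, T⟩.
  refine ⟨_, ((hasStrictDerivAt_inv hne).comp_hasStrictFDerivAt θ0 d1).smul dT, fun v w => ?_⟩
  simp only [sub_self, inner_zero_left, Real.exp_zero, one_smul] at i1 iT iT0
  rw [covariance_eq_sub (hT.memLp_inner v) (hT.memLp_inner w)]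
  have hv : ∫ x, ⟪v, T x⟫ ∂P = ⟪v, ∫ x, T x ∂P⟫ := integral_inner iT0 v
  have e1 : (∫ x, tiltDeriv T (fun _ => (1 : ℝ)) x ∂P) w = ∫ x, ⟪w, T x⟫ ∂P := by
    rw [ContinuousLinearMap.integral_apply i1]
    simp [tiltDeriv, real_inner_comm]
  have e2 : ⟪v, (∫ x, tiltDeriv T T x ∂P) w⟫ = ∫ x, ⟪v, T x⟫ * ⟪w, T x⟫ ∂P := by
    rw [ContinuousLinearMap.integral_apply iT, ← integral_inner]
    · simp [tiltDeriv, inner_smul_right, real_inner_comm, mul_comm]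
    · exact iT.apply_continuousLinearMap w
  simp only [sub_self, inner_zero_left, Real.exp_zero, one_smul, Pi.mul_apply]
  simp [e1, e2, hv, inner_add_right, inner_smul_right]
  ring

lemma covariance_self_pos (hT : IsTiltedFamily P Θ θ0 T ψ) {v : E p} (hv : v ≠ 0) :
    0 < cov[fun x => ⟪v, T x⟫, fun x => ⟪v, T x⟫; P] := by
  have := hT.isProb
  have hm := hT.memLp_inner v
  rw [covariance_self hm.aemeasurable]
  exact lt_of_le_of_ne (variance_nonneg _ _) fun h =>
    hT.not_const v hv _ (ae_eq_integral_of_variance_eq_zero hm h.symm)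

lemma covariance_inner (hT : IsTiltedFamily P Θ θ0 T ψ) (v w : E p) :
    cov[fun x => ⟪v, T x⟫, fun x => ⟪w, T x⟫; P]
      = ∑ a, ∑ b, v a * w b * cov[fun x => T x a, fun x => T x b; P] := by
  have := hT.isProb
  have hc : ∀ a, MemLp (fun x => T x a) 2 P := fun a => by
    simpa [EuclideanSpace.inner_single_left] using hT.memLp_inner (EuclideanSpace.single a 1)
  have e : ∀ v : E p, (fun x => ⟪v, T x⟫) = fun x => ∑ a, v a * T x a := fun v => by
    ext x; simp [PiLp.inner_apply, mul_comm]
  rw [e, e, covariance_fun_sum_fun_sum (fun a => (hc a).const_mul _) fun b => (hc b).const_mul _]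
  simp_rw [covariance_const_mul_left, covariance_const_mul_right, mul_assoc]

end IsTiltedFamily

/-! ### Averaging weights of the communication network -/

/-- The total weight `∑_{k=1}^t [A^{t-k}]_{ji}` that agent `j` gives to agent `i` up to time `t`. -/
def weight {m : ℕ} (A : Matrix (Fin m) (Fin m) ℝ) (t : ℕ) (j i : Fin m) : ℝ :=
  ∑ k ∈ Finset.Icc 1 t, (A ^ (t - k)) j i

lemma weight_eq_sum_range {m : ℕ} (A : Matrix (Fin m) (Fin m) ℝ) (t : ℕ) (j i : Fin m) :
    weight A t j i = ∑ s ∈ Finset.range t, (A ^ s) j i := by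
  refine Finset.sum_nbij' (fun k => t - k) (fun s => t - s) ?_ ?_ ?_ ?_ ?_ <;> intro k hk <;>
    simp only [Finset.mem_Icc, Finset.mem_range] at hk ⊢ <;> omega

lemma logPartition_eq_sum_weight {p m : ℕ} (A : Matrix (Fin m) (Fin m) ℝ) (ψ : Fin m → E p → ℝ)
    (t : ℕ) (j : Fin m) (θ : E p) :
    logPartition A ψ t j θ = ∑ i, weight A t j i * ψ i θ := by
  simp_rw [logPartition, weight, Finset.sum_mul]
  exact Finset.sum_comm

namespace IsCommunicationMatrix

variable {m : ℕ} {G : SimpleGraph (Fin m)} {A : Matrix (Fin m) (Fin m) ℝ}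

lemma pow_nonneg (hA : IsCommunicationMatrix G A) (s : ℕ) (i j : Fin m) : 0 ≤ (A ^ s) i j := by
  induction s generalizing i j with
  | zero => simp only [pow_zero, Matrix.one_apply]; split_ifs <;> norm_num
  | succ s ih =>
    rw [pow_succ, Matrix.mul_apply]
    exact Finset.sum_nonneg fun k _ => mul_nonneg (ih i k) (hA.nonneg k j)

lemma pow_row_sum (hA : IsCommunicationMatrix G A) (s : ℕ) (i : Fin m) :
    ∑ j, (A ^ s) i j = 1 := by
  induction s generalizing i with
  | zero => simp [Matrix.one_apply]
  | succ s ih =>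
    simp_rw [pow_succ, Matrix.mul_apply]
    rw [Finset.sum_comm]
    simp_rw [← Finset.mul_sum, hA.row_sum, mul_one, ih]

lemma pow_le_one (hA : IsCommunicationMatrix G A) (s : ℕ) (i j : Fin m) : (A ^ s) i j ≤ 1 := by
  rw [← hA.pow_row_sum s i]
  exact Finset.single_le_sum (fun k _ => hA.pow_nonneg s i k) (Finset.mem_univ j)

lemma pow_symm (hA : IsCommunicationMatrix G A) (s : ℕ) (i j : Fin m) :
    (A ^ s) i j = (A ^ s) j i :=
  (hA.symm.pow s).apply j i

lemma weight_nonneg (hA : IsCommunicationMatrix G A) (t : ℕ) (j i : Fin m) :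
    0 ≤ weight A t j i :=
  Finset.sum_nonneg fun _ _ => hA.pow_nonneg _ _ _

lemma weight_self_pos (hA : IsCommunicationMatrix G A) {t : ℕ} (ht : 1 ≤ t) (j : Fin m) :
    0 < weight A t j j := by
  refine lt_of_lt_of_le one_pos ?_
  have := Finset.single_le_sum (f := fun k => (A ^ (t - k)) j j) (fun k _ => hA.pow_nonneg _ _ _)
    (Finset.right_mem_Icc.2 ht)
  simpa [weight] using this

/-- Rows are probability vectors, so Cauchy–Schwarz applies row by row; by symmetry the columns also
sum to one. -/
lemma sum_sq_mulVec_le (hA : IsCommunicationMatrix G A) (x : Fin m → ℝ) :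
    ∑ i, (A.mulVec x i) ^ 2 ≤ ∑ i, x i ^ 2 := by
  calc ∑ i, (A.mulVec x i) ^ 2 ≤ ∑ i, ∑ k, A i k * x k ^ 2 := by
        refine Finset.sum_le_sum fun i _ => ?_
        have := Finset.sum_sq_le_sum_mul_sum_of_sq_le_mul Finset.univ
          (r := fun k => A i k * x k) (f := fun k => A i k) (g := fun k => A i k * x k ^ 2)
          (fun k _ => hA.nonneg i k) (fun k _ => mul_nonneg (hA.nonneg i k) (sq_nonneg _))
          (fun k _ => le_of_eq (by ring))
        rw [hA.row_sum, one_mul] at this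
        exact this
    _ = ∑ i, x i ^ 2 := by
        rw [Finset.sum_comm]
        refine Finset.sum_congr rfl fun k _ => ?_
        rw [← Finset.sum_mul]
        simp_rw [fun i => hA.symm.apply k i]
        rw [hA.row_sum, one_mul]

/-- The fixed vectors of the communication matrix are constant. -/
lemma eq_of_mulVec_eq (hA : IsCommunicationMatrix G A) {x : Fin m → ℝ} (hx : A.mulVec x = x)
    (a b : Fin m) : x a = x b := by
  -- This Dirichlet form equals 2‖x‖² - 2⟨x, Ax⟩, which vanishes when Ax = x. Then x agrees along
  -- edges, and connectedness propagates this along walks.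
  have h1 : ∑ i, ∑ k, A i k * (x i - x k) ^ 2 = 0 := by
    have e : ∀ i k, A i k * (x i - x k) ^ 2
        = A i k * x i ^ 2 + A i k * x k ^ 2 - 2 * (x i * (A i k * x k)) := fun i k => by ring
    simp_rw [e, Finset.sum_sub_distrib, Finset.sum_add_distrib, ← Finset.mul_sum, ← Finset.sum_mul,
      hA.row_sum]
    rw [Finset.sum_comm (f := fun i k => A i k * x k ^ 2)]
    simp_rw [← Finset.sum_mul, fun i k => hA.symm.apply k i, hA.row_sum]
    have h2 : ∀ i, ∑ k, A i k * x k = x i := fun i => congrFun hx i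
    simp_rw [h2, one_mul, ← sq]
    ring
  have h2 : ∀ i k, A i k * (x i - x k) ^ 2 = 0 := by
    have hnn : ∀ i k, 0 ≤ A i k * (x i - x k) ^ 2 := fun i k =>
      mul_nonneg (hA.nonneg i k) (sq_nonneg _)
    intro i k
    have h3 := (Finset.sum_eq_zero_iff_of_nonneg
      (fun i _ => Finset.sum_nonneg fun k _ => hnn i k)).1 h1 i (Finset.mem_univ i)
    exact (Finset.sum_eq_zero_iff_of_nonneg (fun k _ => hnn i k)).1 h3 k (Finset.mem_univ k)
  have h3 : ∀ i k, G.Adj i k → x i = x k := fun i k h => by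
    have hpos := (hA.adj_iff i k h.ne).2 h
    have := (mul_eq_zero.1 (h2 i k)).resolve_left hpos.ne'
    exact sub_eq_zero.1 (pow_eq_zero_iff two_ne_zero |>.1 this)
  obtain ⟨w⟩ := hA.connected.preconnected a b
  induction w with
  | nil => rfl
  | cons h _ ih => exact (h3 _ _ h).trans ih

/-- In the long run every agent gives the same average weight to all agents. -/
lemma tendsto_weight_div (hA : IsCommunicationMatrix G A) (j i : Fin m) :
    Tendsto (fun t : ℕ => weight A t j i / t) atTop (𝓝 (1 / (m : ℝ))) := by
  -- The weight divided by t is the j-th coordinate of the Birkhoff average of the i-th basis vector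
  -- under A. By the mean ergodic theorem for contractions it converges to the projection onto the
  -- fixed space.
  set f : EuclideanSpace ℝ (Fin m) →L[ℝ] EuclideanSpace ℝ (Fin m) :=
    Matrix.toEuclideanCLM (𝕜 := ℝ) A with hf
  have hfa : ∀ x, (f x).ofLp = A.mulVec x.ofLp := fun x => by
    rw [hf, Matrix.ofLp_toEuclideanCLM]
  have hnorm : ‖f‖ ≤ 1 := by
    refine f.opNorm_le_bound zero_le_one fun x => ?_
    rw [one_mul, EuclideanSpace.norm_eq, EuclideanSpace.norm_eq]
    refine Real.sqrt_le_sqrt ?_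
    simp only [Real.norm_eq_abs, sq_abs]
    simpa [hfa] using hA.sum_sq_mulVec_le x.ofLp
  have hiter : ∀ s : ℕ, ∀ x, (f^[s] x).ofLp = (A ^ s).mulVec x.ofLp := by
    intro s
    induction s with
    | zero => simp
    | succ s ih =>
      intro x
      rw [Function.iterate_succ_apply', hfa, ih, Matrix.mulVec_mulVec, pow_succ']
  set e : EuclideanSpace ℝ (Fin m) := EuclideanSpace.single i 1 with he
  set one : EuclideanSpace ℝ (Fin m) := WithLp.toLp 2 fun _ => 1 with hone
  set K := f.eqLocus (1 : EuclideanSpace ℝ (Fin m) →L[ℝ] EuclideanSpace ℝ (Fin m)) with hK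
  have hlim := f.tendsto_birkhoffAverage_orthogonalProjection hnorm e
  set q := K.orthogonalProjectionOnto e with hq
  have hqK : f (q : EuclideanSpace ℝ (Fin m)) = q := q.2
  have hconst : ∀ a b, (q : EuclideanSpace ℝ (Fin m)) a = (q : EuclideanSpace ℝ (Fin m)) b :=
    hA.eq_of_mulVec_eq (by rw [← hfa, hqK])
  have honeK : one ∈ K := by
    change f one = one
    ext a
    rw [hfa]
    simp [hone, Matrix.mulVec, dotProduct, hA.row_sum]
  -- The projection is a constant vector; orthogonality of the residual to `one` makes its
  -- coordinates sum to one, so each is 1/m.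
  have horth : ⟪one, e - (q : EuclideanSpace ℝ (Fin m))⟫ = 0 := by
    rw [real_inner_comm]
    exact K.starProjection_inner_eq_zero e one honeK
  have hval : (q : EuclideanSpace ℝ (Fin m)) j = 1 / (m : ℝ) := by
    rw [inner_sub_right, he, EuclideanSpace.inner_single_right, PiLp.inner_apply] at horth
    simp only [hone, fun a => hconst a j] at horth
    have hm : (m : ℝ) ≠ 0 := by
      have := Fin.pos j
      positivity
    simp at horth
    field_simp
    linarith
  rw [← hval]
  have hcont := ((EuclideanSpace.proj (𝕜 := ℝ) j).continuous.tendsto _).comp hlim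
  refine hcont.congr fun t => ?_
  simp only [Function.comp_apply, birkhoffAverage, birkhoffSum, id_eq, weight_eq_sum_range,
    PiLp.proj_apply, PiLp.smul_apply, WithLp.ofLp_sum, Finset.sum_apply, hiter, smul_eq_mul]
  rw [div_eq_inv_mul]
  congr 1
  refine Finset.sum_congr rfl fun s _ => ?_
  simp [he]

end IsCommunicationMatrix

/-! ### Sequences of locally quadratic convex functions -/

/-- The divergence `f b - f a - ⟨∇f(a), b - a⟩`. -/
def bregman {p : ℕ} (f : E p → ℝ) (a b : E p) : ℝ := f b - f a - ⟪gradient f a, b - a⟫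

/-- The functions `B t` are strictly above their tangents on `Θ`, and near `θ0` they have the
uniform second-order expansion `t Q / 2` with a positive definite form `Q`. -/
structure IsLocallyQuadratic {p : ℕ} (Θ : Set (E p)) (θ0 : E p) (B : ℕ → E p → ℝ)
    (Q : E p → ℝ) : Prop where
  isOpen : IsOpen Θ
  mem : θ0 ∈ Θ
  differentiableAt : ∀ t, ∀ θ ∈ Θ, DifferentiableAt ℝ (B t) θ
  bregman_pos : ∀ t, 1 ≤ t → ∀ a ∈ Θ, ∀ b ∈ Θ, a ≠ b → 0 < bregman (B t) a b
  expansion : ∀ ε > 0, ∃ δ > 0, ∀ᶠ t in atTop, ∀ a ∈ Metric.ball θ0 δ, ∀ b ∈ Metric.ball θ0 δ,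
    |bregman (B t) a b - t / 2 * Q (b - a)| ≤ ε * t * ‖b - a‖ ^ 2
  continuous_form : Continuous Q
  form_smul : ∀ (s : ℝ) y, Q (s • y) = s ^ 2 * Q y
  coercive : ∃ c > 0, ∀ y, c * ‖y‖ ^ 2 ≤ Q y

/-- The filter of pairs `(t, χ)` with `t → ∞` and `(χ - ∇B_t(θ0)) / t → 0`. -/
def dataFilter {p : ℕ} (B : ℕ → E p → ℝ) (θ0 : E p) : Filter (ℕ × E p) :=
  comap (fun z => (z.1, (z.1 : ℝ)⁻¹ • (z.2 - gradient (B z.1) θ0))) (atTop ×ˢ 𝓝 0)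

/-- Dominated convergence along a filter requires countable generation. -/
instance {p : ℕ} (B : ℕ → E p → ℝ) (θ0 : E p) : (dataFilter B θ0).IsCountablyGenerated := by
  unfold dataFilter; infer_instance

lemma tendsto_dataFilter {p : ℕ} (B : ℕ → E p → ℝ) (θ0 : E p) :
    Tendsto (fun z : ℕ × E p => (z.1, (z.1 : ℝ)⁻¹ • (z.2 - gradient (B z.1) θ0)))
      (dataFilter B θ0) (atTop ×ˢ 𝓝 0) :=
  tendsto_comap

lemma tendsto_fst_dataFilter {p : ℕ} (B : ℕ → E p → ℝ) (θ0 : E p) :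
    Tendsto Prod.fst (dataFilter B θ0) atTop :=
  (tendsto_dataFilter B θ0).fst

lemma tendsto_score_dataFilter {p : ℕ} (B : ℕ → E p → ℝ) (θ0 : E p) :
    Tendsto (fun z : ℕ × E p => (z.1 : ℝ)⁻¹ • (z.2 - gradient (B z.1) θ0)) (dataFilter B θ0)
      (𝓝 0) :=
  (tendsto_dataFilter B θ0).snd

namespace IsLocallyQuadratic

variable {p : ℕ} {Θ : Set (E p)} {θ0 : E p} {B : ℕ → E p → ℝ} {Q : E p → ℝ}

/-- If the gradients at a and b agree, the two divergences between a and b add up to zero, yet both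
are positive. -/
lemma injOn_gradient (hB : IsLocallyQuadratic Θ θ0 B Q) {t : ℕ} (ht : 1 ≤ t) :
    Set.InjOn (gradient (B t)) Θ := by
  intro a ha b hb hab
  by_contra hne
  have h1 := hB.bregman_pos t ht a ha b hb hne
  have h2 := hB.bregman_pos t ht b hb a ha (Ne.symm hne)
  simp only [bregman, hab, inner_sub_right] at h1 h2
  linarith

lemma bregman_nonneg (hB : IsLocallyQuadratic Θ θ0 B Q) {t : ℕ} (ht : 1 ≤ t) {a b : E p}
    (ha : a ∈ Θ) (hb : b ∈ Θ) : 0 ≤ bregman (B t) a b := by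
  rcases eq_or_ne a b with rfl | h
  · simp [bregman]
  · exact (hB.bregman_pos t ht a ha b hb h).le

/-- Divergences from a point of `Θ` grow at least linearly along rays. -/
lemma bregman_segment_le (hB : IsLocallyQuadratic Θ θ0 B Q) {t : ℕ} (ht : 1 ≤ t) {a b : E p}
    {r : ℝ} (hr0 : 0 ≤ r) (hr1 : r ≤ 1) (ha : a ∈ Θ) (hb : b ∈ Θ) (hz : a + r • (b - a) ∈ Θ) :
    bregman (B t) a (a + r • (b - a)) ≤ r * bregman (B t) a b := by
  -- The tangent at the intermediate point lies below the function at both endpoints; averaging with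
  -- weights 1 - r and r cancels its gradient. Convexity of Θ is not needed.
  have h1 := hB.bregman_nonneg ht hz ha
  have h2 := hB.bregman_nonneg ht hz hb
  set z := a + r • (b - a) with hz'
  have e1 : a - z = (-r) • (b - a) := by rw [hz']; module
  have e2 : b - z = (1 - r) • (b - a) := by rw [hz']; module
  have e3 : z - a = r • (b - a) := by rw [hz']; module
  rw [bregman, e1, inner_smul_right] at h1
  rw [bregman, e2, inner_smul_right] at h2
  rw [bregman, bregman, e3, inner_smul_right]
  nlinarith [mul_nonneg (sub_nonneg.2 hr1) h1, mul_nonneg hr0 h2]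

/-- Quadratic growth near `θ0`. -/
lemma exists_quadratic_growth (hB : IsLocallyQuadratic Θ θ0 B Q) :
    ∃ c > 0, ∃ δ > 0, Metric.ball θ0 δ ⊆ Θ ∧ ∀ᶠ t : ℕ in atTop,
      ∀ a ∈ Metric.ball θ0 δ, ∀ b ∈ Metric.ball θ0 δ, c * t * ‖b - a‖ ^ 2 ≤ bregman (B t) a b := by
  obtain ⟨c, hc, hQ⟩ := hB.coercive
  -- An error of c/4 leaves c/2 - c/4 = c/4 of the quadratic term.
  obtain ⟨δ1, hδ1, h1⟩ := hB.expansion (c / 4) (by positivity)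
  obtain ⟨δ2, hδ2, h2⟩ := Metric.isOpen_iff.1 hB.isOpen θ0 hB.mem
  refine ⟨c / 4, by positivity, min δ1 δ2, lt_min hδ1 hδ2,
    (Metric.ball_subset_ball (min_le_right _ _)).trans h2, ?_⟩
  filter_upwards [h1] with t ht a ha b hb
  have h3 := abs_le.1 (ht a (Metric.ball_subset_ball (min_le_left _ _) ha) b
    (Metric.ball_subset_ball (min_le_left _ _) hb))
  have h4 : (t : ℝ) / 2 * (c * ‖b - a‖ ^ 2) ≤ t / 2 * Q (b - a) :=
    mul_le_mul_of_nonneg_left (hQ _) (by positivity)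
  linarith [h3.1]

/-- Linear lower bound for the divergence away from `θ0`. -/
lemma exists_growth (hB : IsLocallyQuadratic Θ θ0 B Q) :
    ∃ c > 0, ∃ δ₀ > 0, Metric.ball θ0 δ₀ ⊆ Θ ∧ ∀ δ > 0, 2 * δ < δ₀ → ∀ᶠ t : ℕ in atTop,
      ∀ a ∈ Metric.ball θ0 δ,
        (∀ b, ‖b - a‖ ≤ δ → c * t * ‖b - a‖ ^ 2 ≤ bregman (B t) a b) ∧
        (∀ b ∈ Θ, δ < ‖b - a‖ → c * t * δ ^ 2 ≤ bregman (B t) a b) := by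
  obtain ⟨c, hc, δ0, hδ0, hsub, h⟩ := hB.exists_quadratic_growth
  refine ⟨c, hc, δ0, hδ0, hsub, fun δ hδ hδδ => ?_⟩
  filter_upwards [h, eventually_ge_atTop 1] with t ht ht1 a ha
  have ha' : a ∈ Metric.ball θ0 δ0 := Metric.ball_subset_ball (by linarith) ha
  have hin : ∀ b, ‖b - a‖ ≤ δ → b ∈ Metric.ball θ0 δ0 := fun b hb => by
    rw [Metric.mem_ball] at ha ⊢
    have := dist_triangle b a θ0
    rw [dist_eq_norm b a] at this
    linarith
  refine ⟨fun b hb => ht a ha' b (hin b hb), fun b hb hab => ?_⟩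
  have hpos : 0 < ‖b - a‖ := hδ.trans hab
  -- The point of the segment at distance δ from a lies in the region of quadratic growth, and the
  -- divergence of b is at least 1/r ≥ 1 times as large.
  set r := δ / ‖b - a‖ with hr
  have hr0 : 0 ≤ r := by positivity
  have hr1 : r ≤ 1 := by rw [hr, div_le_one hpos]; exact hab.le
  have hz : ‖a + r • (b - a) - a‖ = δ := by
    rw [add_sub_cancel_left, norm_smul, Real.norm_eq_abs, abs_of_nonneg hr0, hr,
      div_mul_cancel₀ _ hpos.ne']
  have hzin := hin _ hz.le
  have h1 := ht a ha' _ hzin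
  have h2 := hB.bregman_segment_le ht1 hr0 hr1 (hsub ha') hb (hsub hzin)
  have h3 := hB.bregman_nonneg ht1 (hsub ha') hb
  rw [hz] at h1
  nlinarith

/-- The equation `∇B_t(θ) = χ` is eventually solvable near `θ0`. -/
lemma eventually_exists_gradient_eq (hB : IsLocallyQuadratic Θ θ0 B Q) {r : ℝ} (hr : 0 < r) :
    ∀ᶠ z in dataFilter B θ0, ∃ θ ∈ Metric.ball θ0 r, θ ∈ Θ ∧ gradient (B z.1) θ = z.2 := by
  obtain ⟨c, hc, δ, hδ, hsub, h⟩ := hB.exists_quadratic_growth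
  set s := min (r / 2) (δ / 2) with hs
  have hs0 : 0 < s := by positivity
  have hsδ : s < δ := (min_le_right _ _).trans_lt (by linarith)
  have hsr : s < r := (min_le_left _ _).trans_lt (by linarith)
  have hcs : 0 < c * s := by positivity
  filter_upwards [(tendsto_fst_dataFilter B θ0).eventually h,
    (tendsto_fst_dataFilter B θ0).eventually (eventually_ge_atTop 1),
    (tendsto_score_dataFilter B θ0).eventually (Metric.ball_mem_nhds 0 hcs)] with ⟨t, χ⟩ ht ht1 hz
  simp only at ht ht1 hz
  have ht0 : (0 : ℝ) < t := by exact_mod_cast ht1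
  rw [dist_zero_right, norm_smul, norm_inv, RCLike.norm_natCast,
    inv_mul_lt_iff₀ ht0] at hz
  have hcb : Metric.closedBall θ0 s ⊆ Θ :=
    (Metric.closedBall_subset_ball hsδ).trans hsub
  have hgrad : ∀ θ ∈ Θ, HasGradientAt (B t) (gradient (B t) θ) θ := fun θ hθ =>
    (hB.differentiableAt t θ hθ).hasGradientAt
  have hcont : ContinuousOn (fun θ => ⟪χ, θ⟫ - B t θ) (Metric.closedBall θ0 s) := fun θ hθ =>
    ((continuous_const.inner continuous_id).continuousAt.sub
      (hB.differentiableAt t θ (hcb hθ)).continuousAt).continuousWithinAt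
  -- A maximizer of the log-likelihood over a small closed ball solves the equation once it is
  -- interior.
  obtain ⟨θ, hθ, hmax⟩ := (isCompact_closedBall θ0 s).exists_isMaxOn
    ⟨θ0, Metric.mem_closedBall_self hs0.le⟩ hcont
  have hlt : dist θ θ0 < s := by
    refine lt_of_le_of_ne hθ fun he => ?_
    -- On the sphere, maximality bounds the divergence from θ0 by ‖χ - ∇B_t(θ0)‖ s < c t s², against
    -- quadratic growth.
    have h1 := hmax (Metric.mem_closedBall_self hs0.le)
    have h2 := ht θ0 (Metric.mem_ball_self hδ) θ (Metric.closedBall_subset_ball hsδ hθ)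
    have h3 := real_inner_le_norm (χ - gradient (B t) θ0) (θ - θ0)
    rw [dist_eq_norm] at he
    simp only [Set.mem_ofPred_eq, bregman, he] at h1 h2 h3
    simp only [inner_sub_left, inner_sub_right] at h2 h3
    nlinarith
  refine ⟨θ, Metric.ball_subset_ball hsr.le hlt, hcb hθ, ?_⟩
  have hloc : IsLocalMax (fun θ => ⟪χ, θ⟫ - B t θ) θ :=
    hmax.isLocalMax (Metric.closedBall_mem_nhds_of_mem hlt)
  have hd : HasFDerivAt (fun θ => ⟪χ, θ⟫ - B t θ)
      (innerSL ℝ χ - InnerProductSpace.toDual ℝ (E p) (gradient (B t) θ)) θ :=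
    (innerSL ℝ χ).hasFDerivAt.sub (hgrad θ (hcb hθ)).hasFDerivAt
  have h0 := hloc.hasFDerivAt_eq_zero hd
  refine ext_inner_right ℝ fun v => ?_
  have := congrArg (fun l => l v) h0
  simp only [sub_apply, innerSL_apply_apply, InnerProductSpace.toDual_apply_apply,
    zero_apply] at this
  linarith

lemma eventually_mem_image (hB : IsLocallyQuadratic Θ θ0 B Q) :
    ∀ᶠ z in dataFilter B θ0, z.2 ∈ gradient (B z.1) '' Θ := by
  filter_upwards [hB.eventually_exists_gradient_eq one_pos] with z ⟨θ, _, hθ, h⟩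
  exact ⟨θ, hθ, h⟩

/-- By injectivity of the gradient, the chosen preimage is the solution found near θ0. -/
lemma tendsto_invFunOn (hB : IsLocallyQuadratic Θ θ0 B Q) :
    Tendsto (fun z => Function.invFunOn (gradient (B z.1)) Θ z.2) (dataFilter B θ0) (𝓝 θ0) := by
  rw [Metric.tendsto_nhds]
  intro r hr
  filter_upwards [hB.eventually_exists_gradient_eq hr,
    (tendsto_fst_dataFilter B θ0).eventually (eventually_ge_atTop 1)] with z ⟨θ, hθr, hθ, h⟩ hz
  rwa [← h, (hB.injOn_gradient hz).leftInvOn_invFunOn hθ]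

end IsLocallyQuadratic

/-! ### Affine rescaling and Laplace approximation of the posterior kernel -/

lemma map_add_smul_volume {p : ℕ} (c : E p) {s : ℝ} (hs : 0 < s) :
    (volume : Measure (E p)).map (fun x => c + s • x)
      = ENNReal.ofReal ((s ^ p)⁻¹) • (volume : Measure (E p)) := by
  have h1 : (fun x : E p => c + s • x) = (fun x => c + x) ∘ fun x => s • x := rfl
  rw [h1, ← Measure.map_map (by fun_prop) (by fun_prop), Measure.map_addHaar_smul _ hs.ne',
    Measure.map_smul, map_add_left_eq_self, finrank_euclideanSpace, Fintype.card_fin,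
    abs_of_pos (by positivity)]

lemma aemeasurable_comp_add_smul {p : ℕ} {β : Type*} [MeasurableSpace β] (c : E p) {s : ℝ}
    (hs : 0 < s) {f : E p → β} (hf : AEMeasurable f volume) :
    AEMeasurable (fun x => f (c + s • x)) volume := by
  refine AEMeasurable.comp_aemeasurable (g := f) (f := fun x : E p => c + s • x) ?_ (by fun_prop)
  rw [map_add_smul_volume c hs]
  exact hf.smul_measure _

lemma lintegral_comp_add_smul {p : ℕ} (c : E p) {s : ℝ} (hs : 0 < s) {f : E p → ℝ≥0∞}
    (hf : AEMeasurable f volume) :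
    ∫⁻ x, f (c + s • x) = ENNReal.ofReal ((s ^ p)⁻¹) * ∫⁻ x, f x := by
  rw [← lintegral_map' (f := f) (g := fun x => c + s • x) _ (by fun_prop),
    map_add_smul_volume c hs, lintegral_smul_measure, smul_eq_mul]
  rw [map_add_smul_volume c hs]
  exact hf.smul_measure _

/-- The density with respect to Lebesgue measure, up to a constant factor, of the posterior for
the prior density `ρ` and the log-likelihood `⟨θ, χ⟩ - f θ`. -/
def posteriorKernel {p : ℕ} (Θ : Set (E p)) (ρ f : E p → ℝ) (χ c : E p) : E p → ℝ :=
  Θ.indicator fun θ => ρ θ * Real.exp (⟪θ - c, χ⟫ - (f θ - f c))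

lemma aemeasurable_posteriorKernel {p : ℕ} {Θ : Set (E p)} (hΘ : IsOpen Θ) {ρ f : E p → ℝ}
    (hρ : AEMeasurable ρ (volume.restrict Θ)) (hf : ContinuousOn f Θ) (χ c : E p) :
    AEMeasurable (posteriorKernel Θ ρ f χ c) volume := by
  have := hf.aemeasurable hΘ.measurableSet (μ := volume)
  refine (aemeasurable_indicator_iff hΘ.measurableSet).2 (hρ.mul ?_)
  exact Real.measurable_exp.comp_aemeasurable
    ((Measurable.aemeasurable (by fun_prop)).sub (this.sub_const _))

lemma posteriorKernel_nonneg {p : ℕ} {Θ : Set (E p)} {ρ f : E p → ℝ} (hρ : ∀ θ, 0 < ρ θ)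
    (χ c θ : E p) : 0 ≤ posteriorKernel Θ ρ f χ c θ :=
  Set.indicator_nonneg (fun θ _ => mul_nonneg (hρ θ).le (Real.exp_nonneg _)) θ

namespace IsLocallyQuadratic

variable {p : ℕ} {Θ : Set (E p)} {θ0 : E p} {B : ℕ → E p → ℝ} {Q : E p → ℝ}

lemma continuousOn (hB : IsLocallyQuadratic Θ θ0 B Q) (t : ℕ) : ContinuousOn (B t) Θ :=
  fun θ hθ => (hB.differentiableAt t θ hθ).continuousAt.continuousWithinAt

lemma integrable_exp_neg_form (hB : IsLocallyQuadratic Θ θ0 B Q) :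
    Integrable (fun x => Real.exp (-(Q x / 2))) volume := by
  obtain ⟨c, hc, h⟩ := hB.coercive
  have hQ := hB.continuous_form
  refine (GaussianFourier.integrable_cexp_neg_mul_sq_norm_add (V := E p) (b := (c / 2 : ℝ))
    (by simpa using hc) 0 0).norm.mono' (by fun_prop) (ae_of_all _ fun x => ?_)
  rw [Real.norm_eq_abs, Real.abs_exp, Complex.norm_exp]
  refine Real.exp_le_exp.2 ?_
  have := h x
  norm_cast
  simp
  linarith

/-- Pointwise limit of the rescaled posterior kernel. -/
lemma tendsto_posteriorKernel (hB : IsLocallyQuadratic Θ θ0 B Q) {ρ : E p → ℝ}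
    (hρc : ContinuousAt ρ θ0) (x : E p) :
    Tendsto (fun z : ℕ × E p => posteriorKernel Θ ρ (B z.1) z.2
      (Function.invFunOn (gradient (B z.1)) Θ z.2)
      (Function.invFunOn (gradient (B z.1)) Θ z.2 + (√z.1)⁻¹ • x))
      (dataFilter B θ0) (𝓝 (ρ θ0 * Real.exp (-(Q x / 2)))) := by
  set e : ℕ × E p → E p := fun z => Function.invFunOn (gradient (B z.1)) Θ z.2 with he
  have hfst := tendsto_fst_dataFilter B θ0
  have h1 : Tendsto e (dataFilter B θ0) (𝓝 θ0) := hB.tendsto_invFunOn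
  have hs : Tendsto (fun z : ℕ × E p => (√z.1)⁻¹) (dataFilter B θ0) (𝓝 0) :=
    tendsto_inv_atTop_zero.comp
      (Real.tendsto_sqrt_atTop.comp (tendsto_natCast_atTop_atTop.comp hfst))
  have h2 : Tendsto (fun z => e z + (√z.1)⁻¹ • x) (dataFilter B θ0) (𝓝 θ0) := by
    simpa using h1.add (hs.smul_const x)
  have hb : Tendsto (fun z => bregman (B z.1) (e z) (e z + (√z.1)⁻¹ • x)) (dataFilter B θ0)
      (𝓝 (Q x / 2)) := by
    rw [Metric.tendsto_nhds]
    intro ε hε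
    -- At distance ‖x‖/√t the factor t cancels and the error is at most ε/2; the `+ 1` covers x = 0.
    obtain ⟨δ, hδ, hexp⟩ := hB.expansion (ε / (2 * (‖x‖ ^ 2 + 1))) (by positivity)
    filter_upwards [hfst.eventually hexp, h1.eventually (Metric.ball_mem_nhds θ0 hδ),
      h2.eventually (Metric.ball_mem_nhds θ0 hδ), hfst.eventually (eventually_ge_atTop 1)]
      with z hz ha hb ht
    have ht0 : (0 : ℝ) < z.1 := by exact_mod_cast ht
    have h3 := hz _ ha _ hb
    rw [add_sub_cancel_left, hB.form_smul, norm_smul, mul_pow, norm_inv, Real.norm_eq_abs,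
      inv_pow, inv_pow, sq_abs, Real.sq_sqrt ht0.le] at h3
    rw [Real.dist_eq]
    have e1 : (z.1 : ℝ) / 2 * ((z.1 : ℝ)⁻¹ * Q x) = Q x / 2 := by field_simp
    have e2 : ε / (2 * (‖x‖ ^ 2 + 1)) * z.1 * ((z.1 : ℝ)⁻¹ * ‖x‖ ^ 2)
        = ε / 2 * (‖x‖ ^ 2 / (‖x‖ ^ 2 + 1)) := by field_simp
    rw [e1, e2] at h3
    refine h3.trans_lt ?_
    have h4 : ‖x‖ ^ 2 / (‖x‖ ^ 2 + 1) ≤ 1 := by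
      rw [div_le_one (by positivity)]; linarith
    nlinarith
  have hlim := (hρc.tendsto.comp h2).mul
    ((Real.continuous_exp.tendsto _).comp hb.neg)
  refine hlim.congr' ?_
  filter_upwards [h2.eventually (hB.isOpen.mem_nhds hB.mem), hB.eventually_mem_image]
    with z hz him
  -- Because the centre solves the gradient equation, the exponent has no linear term: it is exactly
  -- minus the divergence.
  have hgr : gradient (B z.1) (e z) = z.2 := Function.invFunOn_eq him
  simp only [Function.comp_apply, posteriorKernel]
  rw [Set.indicator_of_mem hz, add_sub_cancel_left]
  congr 2
  rw [bregman, hgr, add_sub_cancel_left, real_inner_comm]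
  ring

/-- **Laplace approximation**: the rescaled posterior kernel converges in `L¹` to a Gaussian
kernel. -/
theorem tendsto_lintegral_posteriorKernel (hB : IsLocallyQuadratic Θ θ0 B Q) {ρ : E p → ℝ}
    (hρ : ∀ θ, 0 < ρ θ) (hρm : AEMeasurable ρ (volume.restrict Θ)) (hρc : ContinuousAt ρ θ0)
    (hρi : ∫⁻ θ in Θ, ENNReal.ofReal (ρ θ) ≠ ∞) :
    Tendsto (fun z : ℕ × E p => ∫⁻ x, ENNReal.ofReal |posteriorKernel Θ ρ (B z.1) z.2
      (Function.invFunOn (gradient (B z.1)) Θ z.2)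
      (Function.invFunOn (gradient (B z.1)) Θ z.2 + (√z.1)⁻¹ • x)
        - ρ θ0 * Real.exp (-(Q x / 2))|) (dataFilter B θ0) (𝓝 0) := by
  set e : ℕ × E p → E p := fun z => Function.invFunOn (gradient (B z.1)) Θ z.2 with he
  set K : ℕ × E p → E p → ℝ := fun z => posteriorKernel Θ ρ (B z.1) z.2 (e z) with hK
  have hfst := tendsto_fst_dataFilter B θ0
  have h1 : Tendsto e (dataFilter B θ0) (𝓝 θ0) := hB.tendsto_invFunOn
  have hKm : ∀ z, AEMeasurable (K z) volume := fun z =>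
    aemeasurable_posteriorKernel hB.isOpen hρm (hB.continuousOn z.1) z.2 (e z)
  have hK0 : ∀ z θ, 0 ≤ K z θ := fun z θ => posteriorKernel_nonneg hρ _ _ _
  have hQ := hB.continuous_form
  obtain ⟨c, hc, δ0, hδ0, hsub, hgrow⟩ := hB.exists_growth
  obtain ⟨δ1, hδ1, hρb⟩ := Metric.eventually_nhds_iff_ball.1
    (hρc.eventually (gt_mem_nhds (show ρ θ0 < 2 * ρ θ0 by linarith [hρ θ0])))
  -- The centre is within δ of θ0 and the inner region within δ of the centre, so radius 2δ must fit
  -- both where growth holds and where ρ < 2ρ(θ0).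
  set δ := min δ0 δ1 / 3 with hδdef
  have hδ : 0 < δ := by positivity
  have hδδ0 : 2 * δ < δ0 := by
    have := min_le_left δ0 δ1
    have : 0 < min δ0 δ1 := by positivity
    rw [hδdef]; linarith
  have hδδ1 : 2 * δ < δ1 := by
    have := min_le_right δ0 δ1
    have : 0 < min δ0 δ1 := by positivity
    rw [hδdef]; linarith
  have hev : ∀ᶠ z in dataFilter B θ0, 1 ≤ z.1 ∧ e z ∈ Metric.ball θ0 δ ∧
      gradient (B z.1) (e z) = z.2 ∧
      (∀ b, ‖b - e z‖ ≤ δ → c * z.1 * ‖b - e z‖ ^ 2 ≤ bregman (B z.1) (e z) b) ∧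
      (∀ b ∈ Θ, δ < ‖b - e z‖ → c * z.1 * δ ^ 2 ≤ bregman (B z.1) (e z) b) := by
    filter_upwards [hfst.eventually (hgrow δ hδ hδδ0), h1.eventually (Metric.ball_mem_nhds θ0 hδ),
      hfst.eventually (eventually_ge_atTop 1), hB.eventually_mem_image] with z hz hb ht him
    exact ⟨ht, hb, Function.invFunOn_eq him, hz _ hb⟩
  have hKeq : ∀ z, gradient (B z.1) (e z) = z.2 → ∀ θ ∈ Θ,
      K z θ = ρ θ * Real.exp (-bregman (B z.1) (e z) θ) := by
    intro z hz θ hθ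
    simp only [hK, posteriorKernel]
    rw [Set.indicator_of_mem hθ, bregman, hz, real_inner_comm]
    congr 2; ring
  -- the two parts of the integral
  set In : ℕ × E p → Set (E p) := fun z => {θ | ‖θ - e z‖ ≤ δ} with hIn
  have hInm : ∀ z, MeasurableSet (In z) := fun z =>
    measurableSet_le (by fun_prop) measurable_const
  have hmono : ∀ z x, ENNReal.ofReal |K z (e z + (√z.1)⁻¹ • x) - ρ θ0 * Real.exp (-(Q x / 2))|
      ≤ ENNReal.ofReal |(In z).indicator (K z) (e z + (√z.1)⁻¹ • x)
          - ρ θ0 * Real.exp (-(Q x / 2))|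
        + ENNReal.ofReal ((In z)ᶜ.indicator (K z) (e z + (√z.1)⁻¹ • x)) := by
    intro z x
    by_cases hx : e z + (√z.1)⁻¹ • x ∈ In z
    · rw [Set.indicator_of_mem hx, Set.indicator_of_notMem (by simpa using hx)]
      simp
    · rw [Set.indicator_of_notMem hx, Set.indicator_of_mem hx,
        ← ENNReal.ofReal_add (abs_nonneg _) (hK0 _ _)]
      refine ENNReal.ofReal_le_ofReal ((abs_sub _ _).trans ?_)
      rw [zero_sub, abs_neg, abs_of_nonneg (hK0 _ _), add_comm]
  have hin : Tendsto (fun z => ∫⁻ x, ENNReal.ofReal |(In z).indicator (K z) (e z + (√z.1)⁻¹ • x)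
      - ρ θ0 * Real.exp (-(Q x / 2))|) (dataFilter B θ0) (𝓝 0) := by
    rw [← lintegral_zero (μ := (volume : Measure (E p)))]
    refine tendsto_lintegral_filter_of_dominated_convergence'
      (fun x => ENNReal.ofReal (2 * ρ θ0 * Real.exp (-(c * ‖x‖ ^ 2))
        + ρ θ0 * Real.exp (-(Q x / 2)))) ?_ ?_ ?_ ?_
    · filter_upwards [hev] with z hz
      have hs : 0 < (√z.1 : ℝ)⁻¹ := by
        have : (0 : ℝ) < z.1 := by exact_mod_cast hz.1
        positivity
      have := aemeasurable_comp_add_smul (e z) hs ((hKm z).indicator (hInm z))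
      fun_prop
    · filter_upwards [hev] with z ⟨ht, hb, hg, hz, _⟩
      refine ae_of_all _ fun x => ENNReal.ofReal_le_ofReal ((abs_sub _ _).trans ?_)
      have ht0 : (0 : ℝ) < z.1 := by exact_mod_cast ht
      rw [abs_of_nonneg (Set.indicator_nonneg (fun θ _ => hK0 z θ) _),
        abs_of_nonneg (mul_nonneg (hρ θ0).le (Real.exp_nonneg _))]
      refine add_le_add ?_ le_rfl
      -- The bound depends on x and is needed only at one point, so the indicator is cut down to
      -- that point.
      refine Set.indicator_le' (g := fun _ => 2 * ρ θ0 * Real.exp (-(c * ‖x‖ ^ 2)))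
        (s := In z ∩ {e z + (√z.1)⁻¹ • x}) (f := K z) ?_ ?_ (e z + (√z.1)⁻¹ • x)
        |>.trans' (le_of_eq ?_)
      · rintro θ ⟨hθ, rfl⟩
        have hbd : e z + (√z.1)⁻¹ • x ∈ Metric.ball θ0 (2 * δ) := by
          rw [Metric.mem_ball] at hb ⊢
          have := dist_triangle (e z + (√z.1)⁻¹ • x) (e z) θ0
          rw [dist_eq_norm _ (e z)] at this
          have h5 : ‖e z + (√z.1)⁻¹ • x - e z‖ ≤ δ := hθ
          linarith
        rw [hKeq z hg _ (hsub (Metric.ball_subset_ball hδδ0.le hbd))]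
        refine mul_le_mul (hρb _ (Metric.ball_subset_ball hδδ1.le hbd)).le ?_
          (Real.exp_nonneg _) (by linarith [hρ θ0])
        refine Real.exp_le_exp.2 (neg_le_neg ((le_of_eq ?_).trans (hz _ hθ)))
        rw [add_sub_cancel_left, norm_smul, mul_pow, norm_inv, Real.norm_eq_abs,
          inv_pow, sq_abs, Real.sq_sqrt ht0.le]
        field_simp
      · intro θ _
        exact mul_nonneg (by linarith [hρ θ0]) (Real.exp_nonneg _)
      · by_cases h : e z + (√z.1)⁻¹ • x ∈ In z <;> simp [Set.indicator, h]
    · have hi : Integrable (fun x : E p => 2 * ρ θ0 * Real.exp (-(c * ‖x‖ ^ 2))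
          + ρ θ0 * Real.exp (-(Q x / 2))) volume := by
        refine Integrable.add (Integrable.const_mul ?_ _) (hB.integrable_exp_neg_form.const_mul _)
        refine (GaussianFourier.integrable_cexp_neg_mul_sq_norm_add (V := E p) (b := (c : ℝ))
          (by simpa using hc) 0 0).norm.congr (ae_of_all _ fun x => ?_)
        simp only [Complex.norm_exp]
        norm_cast
        simp
      exact (hi.lintegral_lt_top).ne
    · refine ae_of_all _ fun x => ?_
      have hlim := hB.tendsto_posteriorKernel hρc x
      have hs : Tendsto (fun z : ℕ × E p => (√z.1)⁻¹) (dataFilter B θ0) (𝓝 0) :=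
        tendsto_inv_atTop_zero.comp
          (Real.tendsto_sqrt_atTop.comp (tendsto_natCast_atTop_atTop.comp hfst))
      have hs' : Tendsto (fun z : ℕ × E p => (√z.1)⁻¹ • x) (dataFilter B θ0) (𝓝 0) := by
        simpa using hs.smul_const x
      have h3 : Tendsto (fun z => (In z).indicator (K z) (e z + (√z.1)⁻¹ • x))
          (dataFilter B θ0) (𝓝 (ρ θ0 * Real.exp (-(Q x / 2)))) := by
        refine hlim.congr' ?_
        filter_upwards [hs'.eventually (Metric.closedBall_mem_nhds 0 hδ)] with z hz
        rw [Set.indicator_of_mem]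
        simpa [hIn] using hz
      have h4 := (h3.sub_const (ρ θ0 * Real.exp (-(Q x / 2)))).abs
      simpa [Function.comp_def] using (ENNReal.continuous_ofReal.tendsto _).comp h4
  have hout : Tendsto (fun z => ∫⁻ x, ENNReal.ofReal ((In z)ᶜ.indicator (K z)
      (e z + (√z.1)⁻¹ • x))) (dataFilter B θ0) (𝓝 0) := by
    have hb0 : 0 < c * δ ^ 2 := by positivity
    -- Outside the δ-ball the kernel is at most exp(-cδ²t) ρ, and ρ has finite mass. The Jacobian
    -- t^(p/2) is bounded crudely by t^p.
    have hexp : Tendsto (fun z : ℕ × E p => ENNReal.ofReal ((z.1 : ℝ) ^ (p : ℝ)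
        * Real.exp (-(c * δ ^ 2) * z.1)) * ∫⁻ θ in Θ, ENNReal.ofReal (ρ θ))
        (dataFilter B θ0) (𝓝 0) := by
      have := (tendsto_rpow_mul_exp_neg_mul_atTop_nhds_zero p _ hb0).comp
        (tendsto_natCast_atTop_atTop.comp hfst)
      have h2 := ENNReal.Tendsto.mul_const (b := ∫⁻ θ in Θ, ENNReal.ofReal (ρ θ))
        ((ENNReal.continuous_ofReal.tendsto _).comp this) (Or.inr hρi)
      simpa using h2
    refine tendsto_of_tendsto_of_tendsto_of_le_of_le' tendsto_const_nhds hexp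
      (Eventually.of_forall fun _ => zero_le) ?_
    filter_upwards [hev] with z ⟨ht, _, hg, _, hz⟩
    have ht1 : (1 : ℝ) ≤ z.1 := by exact_mod_cast ht
    have hs : 0 < (√z.1 : ℝ)⁻¹ := by positivity
    have hpt : ∀ θ, ENNReal.ofReal ((In z)ᶜ.indicator (K z) θ)
        ≤ ENNReal.ofReal (Real.exp (-(c * δ ^ 2) * z.1))
          * Θ.indicator (fun θ => ENNReal.ofReal (ρ θ)) θ := by
      intro θ
      by_cases h1 : θ ∈ In z
      · simp [h1]
      by_cases h2 : θ ∈ Θ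
      · rw [Set.indicator_of_mem h1, Set.indicator_of_mem h2, hKeq z hg θ h2,
          ← ENNReal.ofReal_mul (Real.exp_nonneg _), mul_comm]
        refine ENNReal.ofReal_le_ofReal (mul_le_mul_of_nonneg_right (Real.exp_le_exp.2 ?_)
          (hρ θ).le)
        have := hz θ h2 (by simpa [hIn] using h1)
        linarith
      · simp [hK, posteriorKernel, h2, Set.indicator]
    rw [lintegral_comp_add_smul (f := fun θ => ENNReal.ofReal ((In z)ᶜ.indicator (K z) θ)) (e z) hs
      ((hKm z).indicator (hInm z).compl).ennreal_ofReal]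
    calc _ ≤ ENNReal.ofReal ((((√z.1)⁻¹ : ℝ) ^ p)⁻¹) *
          ∫⁻ θ, ENNReal.ofReal (Real.exp (-(c * δ ^ 2) * z.1))
          * Θ.indicator (fun θ => ENNReal.ofReal (ρ θ)) θ := by
            gcongr with θ; exact hpt θ
      _ = ENNReal.ofReal ((((√z.1)⁻¹ : ℝ) ^ p)⁻¹) *
          ENNReal.ofReal (Real.exp (-(c * δ ^ 2) * z.1)) * ∫⁻ θ in Θ, ENNReal.ofReal (ρ θ) := by
            rw [lintegral_const_mul' _ _ ENNReal.ofReal_ne_top,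
              lintegral_indicator hB.isOpen.measurableSet, mul_assoc]
      _ ≤ _ := by
            rw [← ENNReal.ofReal_mul (by positivity)]
            refine mul_le_mul_left (ENNReal.ofReal_le_ofReal ?_) _
            refine mul_le_mul_of_nonneg_right ?_ (Real.exp_nonneg _)
            rw [inv_pow, inv_inv, Real.rpow_natCast]
            refine pow_le_pow_left₀ (Real.sqrt_nonneg _) ?_ p
            rw [Real.sqrt_le_left (by positivity)]
            nlinarith
  have hsum := hin.add hout
  rw [add_zero] at hsum
  refine tendsto_of_tendsto_of_tendsto_of_le_of_le' tendsto_const_nhds hsum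
    (Eventually.of_forall fun _ => zero_le) ?_
  filter_upwards [hev] with z hz
  have hs : 0 < (√z.1 : ℝ)⁻¹ := by
    have : (0 : ℝ) < z.1 := by exact_mod_cast hz.1
    positivity
  rw [← lintegral_add_right' _ (aemeasurable_comp_add_smul (e z) hs
    ((hKm z).indicator (hInm z).compl)).ennreal_ofReal]
  exact lintegral_mono (hmono z)

end IsLocallyQuadratic

/-! ### Quadratic forms and second-order expansion of log-partition functions -/

/-- The quadratic form of a matrix. -/
def quadForm {p : ℕ} (V : Matrix (Fin p) (Fin p) ℝ) (y : E p) : ℝ := y.ofLp ⬝ᵥ V.mulVec y.ofLp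

lemma continuous_quadForm {p : ℕ} (V : Matrix (Fin p) (Fin p) ℝ) : Continuous (quadForm V) := by
  unfold quadForm
  simp only [dotProduct, Matrix.mulVec]
  fun_prop

lemma quadForm_smul {p : ℕ} (V : Matrix (Fin p) (Fin p) ℝ) (s : ℝ) (y : E p) :
    quadForm V (s • y) = s ^ 2 * quadForm V y := by
  simp only [quadForm, WithLp.ofLp_smul, Matrix.mulVec_smul, dotProduct_smul, smul_dotProduct,
    smul_eq_mul]
  ring

lemma quadForm_pos {p : ℕ} {V : Matrix (Fin p) (Fin p) ℝ} (hV : V.PosDef) {y : E p}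
    (hy : y ≠ 0) : 0 < quadForm V y := by
  have := hV.dotProduct_mulVec_pos (x := y.ofLp) (by simpa using hy)
  simpa [quadForm] using this

/-- A positive definite matrix is coercive. -/
lemma exists_le_quadForm {p : ℕ} {V : Matrix (Fin p) (Fin p) ℝ} (hV : V.PosDef) :
    ∃ c > 0, ∀ y : E p, c * ‖y‖ ^ 2 ≤ quadForm V y := by
  -- The sphere is empty only for p = 0, where any constant works; otherwise c is the minimum over
  -- the sphere.
  rcases (Metric.sphere (0 : E p) 1).eq_empty_or_nonempty with he | hne
  · refine ⟨1, one_pos, fun y => ?_⟩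
    have hy : y = 0 := by
      by_contra h
      have : ‖y‖⁻¹ • y ∈ Metric.sphere (0 : E p) 1 := by
        simp [norm_smul, inv_mul_cancel₀ (norm_ne_zero_iff.2 h)]
      simp [he] at this
    simp [hy, quadForm]
  obtain ⟨y0, hy0, hmin⟩ := (isCompact_sphere (0 : E p) 1).exists_isMinOn hne
    (continuous_quadForm V).continuousOn
  refine ⟨quadForm V y0, quadForm_pos hV (ne_zero_of_mem_unit_sphere ⟨y0, hy0⟩), fun y => ?_⟩
  rcases eq_or_ne y 0 with rfl | h
  · simp [quadForm]
  have hn : ‖y‖ ≠ 0 := norm_ne_zero_iff.2 h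
  have h1 : quadForm V y0 ≤ quadForm V (‖y‖⁻¹ • y) :=
    hmin (by simp [norm_smul, inv_mul_cancel₀ hn])
  rw [quadForm_smul, inv_pow, ← div_eq_inv_mul, le_div_iff₀ (by positivity)] at h1
  exact h1

namespace IsTiltedFamily

variable {p : ℕ} {𝒳 : Type*} [MeasurableSpace 𝒳] {P : Measure 𝒳} {Θ : Set (E p)} {θ0 : E p}

/-- Second-order expansion of the log-partition function, uniformly near `θ0`. -/
lemma exists_expansion {T : 𝒳 → E p} {ψ : E p → ℝ} (hT : IsTiltedFamily P Θ θ0 T ψ) {ε : ℝ}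
    (hε : 0 < ε) : ∃ δ > 0, ∀ a ∈ Metric.ball θ0 δ, ∀ b ∈ Metric.ball θ0 δ,
      |bregman ψ a b - 1 / 2 * cov[fun x => ⟪b - a, T x⟫, fun x => ⟪b - a, T x⟫; P]|
        ≤ ε * ‖b - a‖ ^ 2 := by
  obtain ⟨H, hH, hcov⟩ := hT.exists_hasStrictFDerivAt_tiltMean
  have hsymm : ∀ v w, ⟪v, H w⟫ = ⟪w, H v⟫ := fun v w => by
    rw [hcov, hcov, covariance_comm]
  -- Strict differentiability bounds the linearization error of the mean map by ε‖x - a‖ for all x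
  -- and a near θ0. The function `f` below has this error as its gradient, by symmetry of H.
  obtain ⟨s, hs, happ⟩ := hH.approximates_deriv_on_nhds (c := ⟨ε, hε.le⟩) (Or.inr hε)
  obtain ⟨δ, hδ, hsub⟩ := Metric.mem_nhds_iff.1 (inter_mem hs (hT.isOpen.mem_nhds hT.mem))
  refine ⟨δ, hδ, fun a ha b hb => ?_⟩
  have hgr : ∀ b ∈ Θ, gradient ψ b = tiltMean P θ0 T b := fun b hb => (hT.hasGradientAt hb).gradient
  set f : E p → ℝ := fun b => ψ b - ⟪tiltMean P θ0 T a, b⟫ - 1 / 2 * ⟪b - a, H (b - a)⟫ with hf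
  have hd : ∀ x ∈ Metric.ball θ0 δ, HasFDerivAt f
      (innerSL ℝ (tiltMean P θ0 T x - tiltMean P θ0 T a - H (x - a))) x := by
    intro x hx
    have h1 := (hT.hasGradientAt (hsub hx).2).hasFDerivAt
    have h2 := (innerSL ℝ (tiltMean P θ0 T a)).hasFDerivAt (x := x)
    have h3 : HasFDerivAt (fun b => b - a) (ContinuousLinearMap.id ℝ (E p)) x :=
      (hasFDerivAt_id x).sub_const a
    have h4 := (h3.inner ℝ (H.hasFDerivAt.comp x h3)).const_mul (1 / 2 : ℝ)
    refine ((h1.sub h2).sub h4).congr_fderiv ?_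
    ext v
    simp only [sub_apply, smul_apply, innerSL_apply_apply, InnerProductSpace.toDual_apply_apply,
      ContinuousLinearMap.comp_apply, ContinuousLinearMap.prod_apply, fderivInnerCLM_apply,
      ContinuousLinearMap.id_apply, Function.comp_apply, smul_eq_mul, inner_sub_left]
    rw [← inner_sub_left x a, hsymm (x - a) v, real_inner_comm v (H (x - a))]
    ring
  -- On this convex set ‖x - a‖ ≤ ‖b - a‖, so the mean value inequality yields ε‖b - a‖ times ‖b -
  -- a‖.
  have hconv : Convex ℝ (Metric.ball θ0 δ ∩ Metric.closedBall a ‖b - a‖) :=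
    (convex_ball θ0 δ).inter (convex_closedBall a _)
  have hmain := hconv.norm_image_sub_le_of_norm_hasFDerivWithin_le (C := ε * ‖b - a‖)
    (fun x hx => (hd x hx.1).hasFDerivWithinAt) (fun x hx => ?_)
    ⟨ha, Metric.mem_closedBall_self (norm_nonneg _)⟩
    ⟨hb, by rw [Metric.mem_closedBall, dist_eq_norm]⟩
  · rw [Real.norm_eq_abs] at hmain
    rw [bregman, hgr a (hsub ha).2, ← hcov]
    convert hmain using 1
    · congr 1
      simp only [hf, sub_self, map_zero, inner_zero_left, inner_sub_right]
      ring
    · ring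
  · rw [innerSL_apply_norm]
    have h1 := happ x (hsub hx.1).1 a (hsub ha).1
    have h2 : ‖x - a‖ ≤ ‖b - a‖ := by simpa [dist_eq_norm] using hx.2
    exact h1.trans (mul_le_mul_of_nonneg_left h2 hε.le)

lemma exists_covariance_le {T : 𝒳 → E p} {ψ : E p → ℝ} (hT : IsTiltedFamily P Θ θ0 T ψ) :
    ∃ M, 0 ≤ M ∧ ∀ y : E p, |cov[fun x => ⟪y, T x⟫, fun x => ⟪y, T x⟫; P]| ≤ M * ‖y‖ ^ 2 := by
  obtain ⟨H, -, hcov⟩ := hT.exists_hasStrictFDerivAt_tiltMean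
  refine ⟨‖H‖, norm_nonneg _, fun y => ?_⟩
  rw [← hcov]
  refine (abs_real_inner_le_norm _ _).trans ?_
  nlinarith [H.le_opNorm y, norm_nonneg y]

end IsTiltedFamily

lemma IsCommunicationMatrix.sum_weight {m : ℕ} {G : SimpleGraph (Fin m)}
    {A : Matrix (Fin m) (Fin m) ℝ} (hA : IsCommunicationMatrix G A) (t : ℕ) (j : Fin m) :
    ∑ i, weight A t j i = t := by
  simp_rw [weight]
  rw [Finset.sum_comm]
  simp [hA.pow_row_sum]

/-! ### The aggregated log-partition function is locally quadratic -/

section network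

variable {p m : ℕ} {𝒳 : Type*} [MeasurableSpace 𝒳] {P : Measure 𝒳} {Θ : Set (E p)} {θ0 : E p}
  {T : Fin m → 𝒳 → E p} {ψ : Fin m → E p → ℝ} {G : SimpleGraph (Fin m)}
  {A : Matrix (Fin m) (Fin m) ℝ}

lemma quadForm_avgCov (hT : ∀ i, IsTiltedFamily P Θ θ0 (T i) (ψ i)) (y : E p) :
    quadForm (avgCov P T) y
      = (1 / (m : ℝ)) * ∑ i, cov[fun x => ⟪y, T i x⟫, fun x => ⟪y, T i x⟫; P] := by
  simp_rw [fun i => (hT i).covariance_inner y y, quadForm, avgCov, dotProduct, Matrix.mulVec,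
    dotProduct, Matrix.of_apply]
  simp only [Finset.mul_sum, Finset.sum_mul]
  rw [Finset.sum_comm_cycle]
  refine Finset.sum_congr rfl fun i _ => Finset.sum_congr rfl fun a _ =>
    Finset.sum_congr rfl fun b _ => ?_
  ring

lemma posDef_avgCov (hT : ∀ i, IsTiltedFamily P Θ θ0 (T i) (ψ i)) (j : Fin m) :
    (avgCov P T).PosDef := by
  refine Matrix.PosDef.of_dotProduct_mulVec_pos ?_ fun x hx => ?_
  · ext a b
    simp [avgCov, covariance_comm]
  · have h := quadForm_avgCov hT (WithLp.toLp 2 x)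
    simp only [quadForm] at h
    rw [star_trivial, h]
    have hm : 0 < m := Fin.pos j
    refine mul_pos (by positivity) (Finset.sum_pos (fun i _ => (hT i).covariance_self_pos ?_)
      ⟨j, Finset.mem_univ j⟩)
    simpa using hx

lemma hasGradientAt_logPartition (hT : ∀ i, IsTiltedFamily P Θ θ0 (T i) (ψ i)) (t : ℕ)
    (j : Fin m) {θ : E p} (hθ : θ ∈ Θ) :
    HasGradientAt (logPartition A ψ t j)
      (∑ i, weight A t j i • tiltMean P θ0 (T i) θ) θ := by
  rw [hasGradientAt_iff_hasFDerivAt]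
  have h : HasFDerivAt (fun θ => ∑ i, weight A t j i * ψ i θ)
      (∑ i, weight A t j i • InnerProductSpace.toDual ℝ (E p) (tiltMean P θ0 (T i) θ)) θ :=
    HasFDerivAt.fun_sum fun i _ => ((hT i).hasGradientAt hθ).hasFDerivAt.const_mul _
  refine (h.congr_fderiv ?_).congr_of_eventuallyEq
    (Eventually.of_forall fun η => logPartition_eq_sum_weight A ψ t j η)
  simp

lemma bregman_logPartition (hT : ∀ i, IsTiltedFamily P Θ θ0 (T i) (ψ i)) (t : ℕ)
    (j : Fin m) {a : E p} (ha : a ∈ Θ) (b : E p) :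
    bregman (logPartition A ψ t j) a b = ∑ i, weight A t j i * bregman (ψ i) a b := by
  simp_rw [bregman, (hasGradientAt_logPartition hT t j ha).gradient,
    fun i => ((hT i).hasGradientAt ha).gradient, logPartition_eq_sum_weight, sum_inner,
    inner_smul_left, mul_sub, Finset.sum_sub_distrib]
  simp

/-- All properties pass to the weighted sum: the weights are nonnegative, agent j's weight on itself
is positive for t ≥ 1, and the limiting weights t/m turn the individual covariances into V. -/
lemma isLocallyQuadratic_logPartition (hA : IsCommunicationMatrix G A)
    (hT : ∀ i, IsTiltedFamily P Θ θ0 (T i) (ψ i)) (j : Fin m) :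
    IsLocallyQuadratic Θ θ0 (fun t => logPartition A ψ t j) (quadForm (avgCov P T)) where
  isOpen := (hT j).isOpen
  mem := (hT j).mem
  differentiableAt t θ hθ := (hasGradientAt_logPartition hT t j hθ).differentiableAt
  continuous_form := continuous_quadForm _
  form_smul := quadForm_smul _
  coercive := exists_le_quadForm (posDef_avgCov hT j)
  bregman_pos t ht a ha b hb hab := by
    have hlt : ∀ i, 0 < bregman (ψ i) a b := fun i => by
      have := (hT i).tangent_lt ha hb hab
      rw [bregman, ((hT i).hasGradientAt ha).gradient]
      linarith
    rw [bregman_logPartition hT t j ha]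
    exact Finset.sum_pos' (fun i _ => mul_nonneg (hA.weight_nonneg t j i) (hlt i).le)
      ⟨j, Finset.mem_univ j, mul_pos (hA.weight_self_pos ht j) (hlt j)⟩
  expansion ε hε := by
    choose δ hδ hexp using fun i => (hT i).exists_expansion (half_pos hε)
    choose M hM0 hM using fun i => (hT i).exists_covariance_le
    set η := ε / (∑ i, M i + 1) with hη
    have hS : 0 ≤ ∑ i, M i := Finset.sum_nonneg fun i _ => hM0 i
    have hη0 : 0 < η := by positivity
    have hηM : η * ∑ i, M i ≤ ε := by
      rw [hη, div_mul_eq_mul_div, div_le_iff₀ (by positivity)]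
      nlinarith
    obtain ⟨r, hr, hrΘ⟩ := Metric.isOpen_iff.1 (hT j).isOpen θ0 (hT j).mem
    have hne : (Finset.univ : Finset (Fin m)).Nonempty := ⟨j, Finset.mem_univ j⟩
    set d := min r (Finset.univ.inf' hne δ) with hd
    have hdi : ∀ i, d ≤ δ i := fun i =>
      (min_le_right _ _).trans (Finset.inf'_le _ (Finset.mem_univ i))
    refine ⟨d, lt_min hr ((Finset.lt_inf'_iff hne).2 fun i _ => hδ i), ?_⟩
    have hw : ∀ᶠ t : ℕ in atTop, ∀ i, |weight A t j i / t - 1 / (m : ℝ)| < η :=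
      eventually_all.2 fun i => by
        simpa [Real.dist_eq] using
          (Metric.tendsto_nhds.1 (hA.tendsto_weight_div j i) η hη0)
    filter_upwards [hw, eventually_ge_atTop 1] with t ht ht1 a ha b hb
    have ht0 : (0 : ℝ) < t := by exact_mod_cast ht1
    set C : Fin m → ℝ := fun i => cov[fun x => ⟪b - a, T i x⟫, fun x => ⟪b - a, T i x⟫; P] with hC
    -- Two errors, each at most half the budget: the expansions of the ψ i, whose weights sum to t,
    -- and the replacement of the weights by t/m, absorbed through the covariance bounds M.
    have e1 : bregman (logPartition A ψ t j) a b - t / 2 * quadForm (avgCov P T) (b - a)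
        = ∑ i, (weight A t j i * (bregman (ψ i) a b - 1 / 2 * C i)
          + 1 / 2 * ((weight A t j i - t * (1 / (m : ℝ))) * C i)) := by
      rw [bregman_logPartition hT t j (hrΘ (Metric.ball_subset_ball (min_le_left _ _) ha)),
        quadForm_avgCov hT, ← mul_assoc, Finset.mul_sum, ← Finset.sum_sub_distrib]
      refine Finset.sum_congr rfl fun i _ => ?_
      ring
    rw [e1]
    refine (Finset.abs_sum_le_sum_abs _ _).trans ?_
    have e2 : ∀ i, |weight A t j i * (bregman (ψ i) a b - 1 / 2 * C i)
          + 1 / 2 * ((weight A t j i - t * (1 / (m : ℝ))) * C i)|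
        ≤ weight A t j i * (ε / 2 * ‖b - a‖ ^ 2) + 1 / 2 * (t * η * (M i * ‖b - a‖ ^ 2)) := by
      intro i
      refine (abs_add_le _ _).trans (add_le_add ?_ ?_)
      · rw [abs_mul, abs_of_nonneg (hA.weight_nonneg t j i)]
        exact mul_le_mul_of_nonneg_left (hexp i a (Metric.ball_subset_ball (hdi i) ha) b
          (Metric.ball_subset_ball (hdi i) hb)) (hA.weight_nonneg t j i)
      · rw [abs_mul, abs_mul, abs_of_pos (by norm_num : (0 : ℝ) < 1 / 2)]
        refine mul_le_mul_of_nonneg_left (mul_le_mul ?_ (hM i _) (abs_nonneg _) (by positivity))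
          (by norm_num)
        have e3 : weight A t j i - t * (1 / (m : ℝ)) = t * (weight A t j i / t - 1 / (m : ℝ)) := by
          field_simp
        rw [e3, abs_mul, abs_of_pos ht0]
        exact mul_le_mul_of_nonneg_left (ht i).le ht0.le
    refine (Finset.sum_le_sum fun i _ => e2 i).trans ?_
    rw [Finset.sum_add_distrib, ← Finset.sum_mul, hA.sum_weight, ← Finset.mul_sum,
      ← Finset.mul_sum, ← Finset.sum_mul]
    have : t * ‖b - a‖ ^ 2 * (η * ∑ i, M i) ≤ t * ‖b - a‖ ^ 2 * ε :=
      mul_le_mul_of_nonneg_left hηM (by positivity)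
    linarith

end network

/-! ### Normalization -/

open scoped MatrixOrder Matrix.Norms.L2Operator in
/-- The Gaussian integral on `ℝᵖ`. -/
lemma lintegral_exp_neg_quadForm {p : ℕ} {V : Matrix (Fin p) (Fin p) ℝ} (hV : V.PosDef) :
    ∫⁻ x : E p, ENNReal.ofReal (Real.exp (-(quadForm V x / 2)))
      = ENNReal.ofReal (√((2 * Real.pi) ^ p * (V⁻¹).det)) := by
  -- Writing V = RᵀR turns the form into ‖Rx‖²; the substitution contributes |det R|⁻¹ = √(det V⁻¹).
  obtain ⟨R, hR⟩ := CStarAlgebra.nonneg_iff_eq_star_mul_self.mp hV.posSemidef.nonneg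
  have hdet : V.det = R.det ^ 2 := by
    rw [hR, Matrix.det_mul, Matrix.star_eq_conjTranspose, Matrix.det_conjTranspose, star_trivial, sq]
  have hR0 : R.det ≠ 0 := fun h => hV.det_pos.ne' (by rw [hdet, h]; simp)
  set f : E p →ₗ[ℝ] E p := Matrix.toLpLin 2 2 R with hf
  have hfdet : LinearMap.det f = R.det := by
    rw [hf, Matrix.toLpLin_eq_toLin, LinearMap.det_toLin]
  have hQ : ∀ x : E p, quadForm V x = ‖f x‖ ^ 2 := fun x => by
    rw [quadForm, hR, EuclideanSpace.norm_sq_eq, ← Matrix.mulVec_mulVec,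
      Matrix.dotProduct_mulVec, Matrix.star_eq_conjTranspose, Matrix.vecMul_conjTranspose,
      star_trivial, star_trivial, dotProduct]
    refine Finset.sum_congr rfl fun i _ => ?_
    rw [Real.norm_eq_abs, sq_abs, sq]
    rfl
  have hmap := Measure.map_linearMap_addHaar_eq_smul_addHaar (volume : Measure (E p)) (f := f)
    (by rwa [hfdet])
  have hfm : Measurable f := f.continuous_of_finiteDimensional.measurable
  have hstep : ∫⁻ x : E p, ENNReal.ofReal (Real.exp (-(quadForm V x / 2)))
      = ENNReal.ofReal |R.det⁻¹| * ∫⁻ x : E p, ENNReal.ofReal (Real.exp (-(1 / 2) * ‖x‖ ^ 2)) := by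
    rw [← hfdet, ← smul_eq_mul, ← lintegral_smul_measure, ← hmap,
      lintegral_map (by fun_prop) hfm]
    refine lintegral_congr fun x => ?_
    rw [hQ]
    congr 2; ring
  have hgauss : ∫⁻ x : E p, ENNReal.ofReal (Real.exp (-(1 / 2) * ‖x‖ ^ 2))
      = ENNReal.ofReal (√((2 * Real.pi) ^ p)) := by
    have hi : Integrable (fun x : E p => Real.exp (-(1 / 2) * ‖x‖ ^ 2)) := by
      refine (GaussianFourier.integrable_cexp_neg_mul_sq_norm_add (V := E p) (b := ((1 / 2 : ℝ) : ℂ))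
        (by rw [Complex.ofReal_re]; norm_num) 0 0).norm.congr (ae_of_all _ fun x => ?_)
      simp only [Complex.norm_exp]
      norm_cast
      simp
    rw [← ofReal_integral_eq_lintegral_ofReal hi (ae_of_all _ fun _ => Real.exp_nonneg _),
      GaussianFourier.integral_rexp_neg_mul_sq_norm (by norm_num), finrank_euclideanSpace,
      Fintype.card_fin, Real.sqrt_eq_rpow, ← Real.rpow_natCast, ← Real.rpow_mul (by positivity)]
    congr 2 <;> ring
  rw [hstep, hgauss, ← ENNReal.ofReal_mul (abs_nonneg _)]
  congr 1
  rw [Matrix.det_nonsing_inv, Ring.inverse_eq_inv', hdet, Real.sqrt_mul (by positivity),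
    Real.sqrt_inv, Real.sqrt_sq_eq_abs, abs_inv, mul_comm]

/-- The density of `√t (θ - c)` when `θ` has a density proportional to `F`. -/
lemma rescaledDensity_withDensity {p : ℕ} {F : E p → ℝ≥0∞} (hF : AEMeasurable F volume) (c : E p)
    {t : ℕ} (ht : 1 ≤ t) (h0 : ∫⁻ x, F (c + (√t)⁻¹ • x) ≠ 0) :
    rescaledDensity ((∫⁻ x, F x)⁻¹ • volume.withDensity F) c t
      =ᵐ[volume] fun y => (∫⁻ x, F (c + (√t)⁻¹ • x))⁻¹ * F (c + (√t)⁻¹ • y) := by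
  have ht0 : (0 : ℝ) < t := by exact_mod_cast ht
  set s : ℝ := (√t)⁻¹ with hs
  have hs0 : 0 < s := by positivity
  have hsm := aemeasurable_comp_add_smul c hs0 hF
  have hcov : ∀ f : E p → ℝ≥0∞, AEMeasurable f volume →
      ∫⁻ x, f x = ENNReal.ofReal (s ^ p) * ∫⁻ x, f (c + s • x) := fun f hf => by
    rw [lintegral_comp_add_smul c hs0 hf, ← mul_assoc, ← ENNReal.ofReal_mul (by positivity),
      mul_inv_cancel₀ (by positivity), ENNReal.ofReal_one, one_mul]
  have hmap : (volume.withDensity F).map (fun θ => √t • (θ - c))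
      = ENNReal.ofReal (s ^ p) • volume.withDensity fun y => F (c + s • y) := by
    ext S hS
    have hm : Measurable fun θ : E p => √t • (θ - c) := by fun_prop
    rw [Measure.map_apply hm hS, withDensity_apply _ (hm hS), Measure.smul_apply,
      withDensity_apply _ hS, ← lintegral_indicator (hm hS), ← lintegral_indicator hS,
      hcov _ (hF.indicator (hm hS)), smul_eq_mul]
    congr 1
    refine lintegral_congr fun x => ?_
    have : √t • (c + s • x - c) = x := by
      rw [add_sub_cancel_left, smul_smul, hs, mul_inv_cancel₀ (by positivity), one_smul]
    have hiff : c + s • x ∈ (fun θ => √t • (θ - c)) ⁻¹' S ↔ x ∈ S := by rw [Set.mem_preimage, this]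
    by_cases hx : x ∈ S
    · rw [Set.indicator_of_mem (hiff.2 hx), Set.indicator_of_mem hx]
    · rw [Set.indicator_of_notMem (mt hiff.1 hx), Set.indicator_of_notMem hx]
  have hpos : ENNReal.ofReal (s ^ p) ≠ 0 := by
    rw [ne_eq, ENNReal.ofReal_eq_zero, not_le]; positivity
  -- The Jacobian s^p occurs in both the density and the normalizer, and cancels.
  rw [rescaledDensity, Measure.map_smul, hmap, smul_smul, hcov F hF,
    ENNReal.mul_inv (Or.inl hpos) (Or.inl ENNReal.ofReal_ne_top), mul_right_comm,
    ENNReal.inv_mul_cancel hpos ENNReal.ofReal_ne_top, one_mul,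
    ← withDensity_smul' _ _ (ENNReal.inv_ne_top.2 h0)]
  exact Measure.rnDeriv_withDensity₀ _ (hsm.const_mul _)

/-- Normalizing two functions at most doubles their relative `L¹` distance. -/
lemma lintegral_abs_normalized_sub_le {α : Type*} [MeasurableSpace α] {ν : Measure α} {k φ : α → ℝ}
    (hk : AEMeasurable k ν) (hφ : AEMeasurable φ ν) (hk0 : ∀ x, 0 ≤ k x) (hφ0 : ∀ x, 0 ≤ φ x)
    {n : ℝ} (hn : 0 < n) (hφn : ∫⁻ x, ENNReal.ofReal (φ x) ∂ν = ENNReal.ofReal n)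
    (hclose : ∫⁻ x, ENNReal.ofReal |k x - φ x| ∂ν < ENNReal.ofReal n) :
    (∫⁻ x, ENNReal.ofReal (k x) ∂ν ≠ 0 ∧ ∫⁻ x, ENNReal.ofReal (k x) ∂ν ≠ ∞) ∧
    ∫⁻ x, ENNReal.ofReal |((∫⁻ x, ENNReal.ofReal (k x) ∂ν)⁻¹ * ENNReal.ofReal (k x)).toReal
        - φ x / n| ∂ν
      ≤ ENNReal.ofReal (2 / n) * ∫⁻ x, ENNReal.ofReal |k x - φ x| ∂ν := by
  set D := ∫⁻ x, ENNReal.ofReal |k x - φ x| ∂ν with hD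
  set N := ∫⁻ x, ENNReal.ofReal (k x) ∂ν with hN
  have hDtop : D ≠ ∞ := (hclose.trans ENNReal.ofReal_lt_top).ne
  have h1 : N ≤ ENNReal.ofReal n + D := by
    rw [← hφn, ← lintegral_add_left' hφ.ennreal_ofReal]
    refine lintegral_mono fun x => ?_
    rw [← ENNReal.ofReal_add (hφ0 x) (abs_nonneg _)]
    exact ENNReal.ofReal_le_ofReal (by linarith [le_abs_self (k x - φ x)])
  have h2 : ENNReal.ofReal n ≤ N + D := by
    rw [← hφn, ← lintegral_add_left' hk.ennreal_ofReal]
    refine lintegral_mono fun x => ?_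
    rw [← ENNReal.ofReal_add (hk0 x) (abs_nonneg _)]
    exact ENNReal.ofReal_le_ofReal (by linarith [neg_abs_le (k x - φ x)])
  have hN0 : N ≠ 0 := fun h => by
    rw [h, zero_add] at h2
    exact absurd hclose h2.not_gt
  have hNtop : N ≠ ∞ := (h1.trans_lt (ENNReal.add_lt_top.2 ⟨ENNReal.ofReal_lt_top, hDtop.lt_top⟩)).ne
  refine ⟨⟨hN0, hNtop⟩, ?_⟩
  obtain ⟨l, hl, hNl⟩ : ∃ l : ℝ, 0 < l ∧ N = ENNReal.ofReal l :=
    ⟨N.toReal, ENNReal.toReal_pos hN0 hNtop, (ENNReal.ofReal_toReal hNtop).symm⟩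
  obtain ⟨d, hd, hDd⟩ : ∃ d : ℝ, 0 ≤ d ∧ D = ENNReal.ofReal d :=
    ⟨D.toReal, ENNReal.toReal_nonneg, (ENNReal.ofReal_toReal hDtop).symm⟩
  rw [hNl, hDd, ← ENNReal.ofReal_add hn.le hd, ENNReal.ofReal_le_ofReal_iff (by positivity)] at h1
  rw [hNl, hDd, ← ENNReal.ofReal_add hl.le hd, ENNReal.ofReal_le_ofReal_iff (by positivity)] at h2
  -- Changing the normalizer costs |n - l|/n ≤ d/n, as much as changing the function; hence the
  -- factor 2.
  have habs : |l⁻¹ - n⁻¹| * l ≤ d / n := by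
    have e : l⁻¹ - n⁻¹ = (n - l) / (l * n) := by field_simp
    rw [e, abs_div, abs_of_pos (mul_pos hl hn), div_mul_eq_mul_div, div_le_div_iff₀ (by positivity) hn]
    have : |n - l| ≤ d := abs_le.2 ⟨by linarith, by linarith⟩
    nlinarith [mul_pos hl hn]
  calc ∫⁻ x, ENNReal.ofReal |(N⁻¹ * ENNReal.ofReal (k x)).toReal - φ x / n| ∂ν
      ≤ ∫⁻ x, (ENNReal.ofReal n⁻¹ * ENNReal.ofReal |k x - φ x|
          + ENNReal.ofReal |l⁻¹ - n⁻¹| * ENNReal.ofReal (k x)) ∂ν := by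
        refine lintegral_mono fun x => ?_
        rw [← ENNReal.ofReal_mul (by positivity), ← ENNReal.ofReal_mul (abs_nonneg _),
          ← ENNReal.ofReal_add (by positivity) (mul_nonneg (abs_nonneg _) (hk0 x)), hNl,
          ← ENNReal.ofReal_inv_of_pos hl, ← ENNReal.ofReal_mul (by positivity),
          ENNReal.toReal_ofReal (mul_nonneg (by positivity) (hk0 x))]
        refine ENNReal.ofReal_le_ofReal ?_
        have e : l⁻¹ * k x - φ x / n = n⁻¹ * (k x - φ x) + (l⁻¹ - n⁻¹) * k x := by
          field_simp; ring
        rw [e]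
        refine (abs_add_le _ _).trans (le_of_eq ?_)
        rw [abs_mul, abs_mul, abs_of_nonneg (hk0 x), abs_of_pos (inv_pos.2 hn)]
    _ = ENNReal.ofReal n⁻¹ * D + ENNReal.ofReal |l⁻¹ - n⁻¹| * N := by
        rw [lintegral_add_right' _ (hk.ennreal_ofReal.const_mul _),
          lintegral_const_mul' _ _ ENNReal.ofReal_ne_top,
          lintegral_const_mul' _ _ ENNReal.ofReal_ne_top]
    _ ≤ ENNReal.ofReal (2 / n) * D := by
        rw [hNl, hDd, ← ENNReal.ofReal_mul (by positivity), ← ENNReal.ofReal_mul (abs_nonneg _),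
          ← ENNReal.ofReal_mul (by positivity),
          ← ENNReal.ofReal_add (by positivity) (mul_nonneg (abs_nonneg _) hl.le)]
        refine ENNReal.ofReal_le_ofReal ?_
        have : 2 / n * d = n⁻¹ * d + d / n := by ring
        linarith

/-! ### From densities with respect to μ to tiltings of the true law -/

section family

variable {p : ℕ} {𝒳 : Type*} [MeasurableSpace 𝒳] {μ : Measure 𝒳} {Θ : Set (E p)} {h : 𝒳 → ℝ}
  {T : 𝒳 → E p} {ψ : E p → ℝ}

lemma IsCanonicalExpFamily.measurable_efDensity (hfam : IsCanonicalExpFamily μ Θ h T ψ)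
    (θ : E p) : Measurable (efDensity h T ψ θ) := by
  have := hfam.measurable_h
  have := hfam.measurable_T
  unfold efDensity
  fun_prop

/-- The tilting factor times the density at θ0 is, up to a constant, the density at θ, which has
mass one. -/
lemma IsCanonicalExpFamily.lintegral_exp (hfam : IsCanonicalExpFamily μ Θ h T ψ) {θ θ0 : E p}
    (hθ : θ ∈ Θ) :
    ∫⁻ x, ENNReal.ofReal (Real.exp ⟪θ - θ0, T x⟫) ∂(efMeasure μ h T ψ θ0)
      = ENNReal.ofReal (Real.exp (ψ θ - ψ θ0)) := by
  have hm := hfam.measurable_T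
  have h1 := (hfam.normalized θ hθ).measure_univ
  rw [efMeasure, withDensity_apply _ MeasurableSet.univ, setLIntegral_univ] at h1
  rw [efMeasure, lintegral_withDensity_eq_lintegral_mul _
    (hfam.measurable_efDensity θ0).ennreal_ofReal (by fun_prop)]
  calc _ = ∫⁻ x, ENNReal.ofReal (Real.exp (ψ θ - ψ θ0)) *
        ENNReal.ofReal (efDensity h T ψ θ x) ∂μ := by
        refine lintegral_congr fun x => ?_
        have hd : 0 ≤ efDensity h T ψ θ0 x := mul_nonneg (hfam.h_nonneg x) (Real.exp_nonneg _)
        rw [Pi.mul_apply, ← ENNReal.ofReal_mul hd, ← ENNReal.ofReal_mul (Real.exp_nonneg _)]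
        congr 1
        rw [efDensity, efDensity, mul_assoc, mul_left_comm (Real.exp (ψ θ - ψ θ0)), ← Real.exp_add, ← Real.exp_add,
          inner_sub_left]
        congr 2; ring
    _ = _ := by rw [lintegral_const_mul' _ _ ENNReal.ofReal_ne_top, h1, mul_one]

lemma IsCanonicalExpFamily.isTiltedFamily (hfam : IsCanonicalExpFamily μ Θ h T ψ)
    (hrank : IsFullRank μ Θ h T ψ) (hΘ : IsOpen Θ) {θ0 : E p} (hθ0 : θ0 ∈ Θ) :
    IsTiltedFamily (efMeasure μ h T ψ θ0) Θ θ0 T ψ where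
  isProb := hfam.normalized θ0 hθ0
  isOpen := hΘ
  mem := hθ0
  measurable_T := hfam.measurable_T
  integrable θ hθ := by
    have hm := hfam.measurable_T
    refine ⟨by fun_prop, ?_⟩
    rw [hasFiniteIntegral_iff_ofReal (ae_of_all _ fun _ => Real.exp_nonneg _),
      hfam.lintegral_exp hθ]
    exact ENNReal.ofReal_lt_top
  integral θ hθ := by
    have hm := hfam.measurable_T
    rw [integral_eq_lintegral_of_nonneg_ae (ae_of_all _ fun _ => Real.exp_nonneg _) (by fun_prop),
      hfam.lintegral_exp hθ, ENNReal.toReal_ofReal (Real.exp_nonneg _)]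
  not_const := hrank θ0 hθ0

/-- Positivity of h at the data is what lets its powers be factored out of the likelihood and
cancelled by the normalizing constant. -/
lemma IsCanonicalExpFamily.ae_pos (hfam : IsCanonicalExpFamily μ Θ h T ψ) (θ0 : E p) :
    ∀ᵐ x ∂(efMeasure μ h T ψ θ0), 0 < h x := by
  rw [efMeasure, ae_withDensity_iff (hfam.measurable_efDensity θ0).ennreal_ofReal]
  refine ae_of_all _ fun x hx => ?_
  by_contra hle
  have h0 : h x = 0 := le_antisymm (not_lt.1 hle) (hfam.h_nonneg x)
  simp [efDensity, h0] at hx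

end family

/-! ### The posterior as a normalized kernel -/

section posterior

variable {p m : ℕ} {𝒳 : Type*} {h : 𝒳 → ℝ} {T : Fin m → 𝒳 → E p} {ψ : Fin m → E p → ℝ}
  {G : SimpleGraph (Fin m)} {A : Matrix (Fin m) (Fin m) ℝ}

/-- The surrogate likelihood is itself of exponential-family form. -/
lemma exists_surrogateLikelihood_eq (hA : IsCommunicationMatrix G A) {x : ℕ → Fin m → 𝒳}
    (hpos : ∀ k i, 0 < h (x k i)) {t : ℕ} (ht : 1 ≤ t) (j : Fin m) :
    ∃ C > 0, ∀ θ, surrogateLikelihood A (fun i => efDensity h (T i) (ψ i)) x t j θ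
      = C * Real.exp (⟪θ, chi A T x t j⟫ - logPartition A ψ t j θ) := by
  refine ⟨h (x t j) * ∏ k ∈ Finset.Icc 1 (t - 1), ∏ i, h (x k i) ^ ((A ^ (t - k)) j i),
    mul_pos (hpos _ _) (Finset.prod_pos fun k _ => Finset.prod_pos fun i _ =>
      Real.rpow_pos_of_pos (hpos k i) _), fun θ => ?_⟩
  have hIcc : Finset.Icc 1 t = insert t (Finset.Icc 1 (t - 1)) := by
    ext k; simp only [Finset.mem_Icc, Finset.mem_insert]; omega
  have hnot : t ∉ Finset.Icc 1 (t - 1) := by simp only [Finset.mem_Icc]; omega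
  have hexp : ⟪θ, chi A T x t j⟫ - logPartition A ψ t j θ
      = (⟪θ, T j (x t j)⟫ - ψ j θ) + ∑ k ∈ Finset.Icc 1 (t - 1), ∑ i,
        (⟪θ, T i (x k i)⟫ - ψ i θ) * (A ^ (t - k)) j i := by
    have e1 : ⟪θ, chi A T x t j⟫ - logPartition A ψ t j θ = ∑ k ∈ Finset.Icc 1 t, ∑ i,
        (⟪θ, T i (x k i)⟫ - ψ i θ) * (A ^ (t - k)) j i := by
      simp_rw [chi, logPartition, inner_sum, inner_smul_right, ← Finset.sum_sub_distrib]
      refine Finset.sum_congr rfl fun k _ => Finset.sum_congr rfl fun i _ => ?_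
      ring
    -- At k = t the weight matrix is A^0 = 1, so only agent j's own latest observation remains, as
    -- in the surrogate likelihood.
    rw [e1, hIcc, Finset.sum_insert hnot]
    simp [Matrix.one_apply]
  rw [hexp, Real.exp_add, Real.exp_sum, surrogateLikelihood, efDensity]
  simp_rw [Real.exp_sum]
  have hprod : ∏ k ∈ Finset.Icc 1 (t - 1), ∏ i, efDensity h (T i) (ψ i) θ (x k i)
        ^ ((A ^ (t - k)) i j)
      = (∏ k ∈ Finset.Icc 1 (t - 1), ∏ i, h (x k i) ^ ((A ^ (t - k)) j i)) *
        ∏ k ∈ Finset.Icc 1 (t - 1), ∏ i, Real.exp ((⟪θ, T i (x k i)⟫ - ψ i θ)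
          * (A ^ (t - k)) j i) := by
    simp_rw [← Finset.prod_mul_distrib]
    refine Finset.prod_congr rfl fun k _ => Finset.prod_congr rfl fun i _ => ?_
    -- The likelihood carries the weight with indices i j and χ with j i; symmetry of A reconciles
    -- them.
    rw [efDensity, Real.mul_rpow (hpos k i).le (Real.exp_nonneg _), ← Real.exp_mul,
      hA.pow_symm (t - k) i j]
  rw [hprod]
  ring

/-- Every factor free of θ is lost in normalization, so the centre c is free: θ0 suits
integrability, the estimator suits the Laplace approximation. -/
lemma posterior_eq (hA : IsCommunicationMatrix G A) {x : ℕ → Fin m → 𝒳}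
    (hpos : ∀ k i, 0 < h (x k i)) {t : ℕ} (ht : 1 ≤ t) (j : Fin m) {Θ : Set (E p)}
    (hΘ : IsOpen Θ) {g : ℝ} (hg : 0 < g) {u : E p} {ψ0 : E p → ℝ}
    (hψ0 : AEMeasurable ψ0 (volume.restrict Θ))
    (hB : ContinuousOn (logPartition A ψ t j) Θ) (c : E p) :
    posterior A (fun i => efDensity h (T i) (ψ i)) (efPrior Θ g u ψ0) x t j
      = (∫⁻ θ, ENNReal.ofReal (posteriorKernel Θ (fun θ => Real.exp (⟪θ, u⟫ - ψ0 θ))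
          (logPartition A ψ t j) (chi A T x t j) c θ))⁻¹ •
        volume.withDensity fun θ => ENNReal.ofReal (posteriorKernel Θ
          (fun θ => Real.exp (⟪θ, u⟫ - ψ0 θ)) (logPartition A ψ t j) (chi A T x t j) c θ) := by
  obtain ⟨C, hC, hL⟩ := exists_surrogateLikelihood_eq (T := T) (ψ := ψ) hA hpos ht j
  set χ := chi A T x t j
  set B := logPartition A ψ t j
  set κ : ℝ := g * C * Real.exp (⟪c, χ⟫ - B c) with hκ
  have hκ0 : 0 < κ := by positivity
  have hBm : AEMeasurable B (volume.restrict Θ) := hB.aemeasurable hΘ.measurableSet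
  have hw : (efPrior Θ g u ψ0).withDensity (fun θ => ENNReal.ofReal
      (surrogateLikelihood A (fun i => efDensity h (T i) (ψ i)) x t j θ))
      = ENNReal.ofReal κ • volume.withDensity fun θ => ENNReal.ofReal (posteriorKernel Θ
          (fun θ => Real.exp (⟪θ, u⟫ - ψ0 θ)) B χ c θ) := by
    simp_rw [hL]
    rw [efPrior, ← withDensity_mul₀, ← withDensity_indicator hΘ.measurableSet,
      ← withDensity_smul' _ _ ENNReal.ofReal_ne_top]
    · congr 1
      ext θ
      by_cases hθ : θ ∈ Θ
      · rw [Set.indicator_of_mem hθ, Pi.mul_apply, Pi.smul_apply, smul_eq_mul, posteriorKernel,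
          Set.indicator_of_mem hθ, ← ENNReal.ofReal_mul (by positivity),
          ← ENNReal.ofReal_mul (by positivity)]
        congr 1
        have : Real.exp (⟪θ, χ⟫ - B θ)
            = Real.exp (⟪c, χ⟫ - B c) * Real.exp (⟪θ - c, χ⟫ - (B θ - B c)) := by
          rw [← Real.exp_add, inner_sub_left]; congr 1; ring
        rw [this, hκ]
        ring
      · rw [Set.indicator_of_notMem hθ, Pi.smul_apply, posteriorKernel, Set.indicator_of_notMem hθ]
        simp
    · have : AEMeasurable (fun θ => ⟪θ, u⟫) (volume.restrict Θ) := by fun_prop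
      exact ((Real.measurable_exp.comp_aemeasurable (this.sub hψ0)).const_mul g).ennreal_ofReal
    · have : AEMeasurable (fun θ => ⟪θ, χ⟫) (volume.restrict Θ) := by fun_prop
      exact ((Real.measurable_exp.comp_aemeasurable (this.sub hBm)).const_mul C).ennreal_ofReal
  have hev : evidence A (fun i => efDensity h (T i) (ψ i)) (efPrior Θ g u ψ0) x t j
      = ENNReal.ofReal κ * ∫⁻ θ, ENNReal.ofReal (posteriorKernel Θ
          (fun θ => Real.exp (⟪θ, u⟫ - ψ0 θ)) B χ c θ) := by
    rw [evidence, ← setLIntegral_univ, ← withDensity_apply _ MeasurableSet.univ, hw,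
      Measure.smul_apply, withDensity_apply _ MeasurableSet.univ, setLIntegral_univ, smul_eq_mul]
  have h0 : ENNReal.ofReal κ ≠ 0 := by simpa using hκ0
  rw [posterior, hw, hev, smul_smul, ENNReal.mul_inv (Or.inl h0) (Or.inl ENNReal.ofReal_ne_top),
    mul_right_comm, ENNReal.inv_mul_cancel h0 ENNReal.ofReal_ne_top, one_mul]

end posterior

lemma chi_eq_sum_product {p m : ℕ} {𝒳 : Type*} (A : Matrix (Fin m) (Fin m) ℝ)
    (T : Fin m → 𝒳 → E p) (x : ℕ → Fin m → 𝒳) (t : ℕ) (j : Fin m) :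
    chi A T x t j = ∑ q ∈ Finset.Icc 1 t ×ˢ Finset.univ,
      (A ^ (t - q.1)) j q.2 • T q.2 (x q.1 q.2) := by
  rw [chi, Finset.sum_product]

/-! ### Law of large numbers for the score and integrability of the posterior -/

section sampling

variable {p m : ℕ} {𝒳 Ω : Type*} [MeasurableSpace 𝒳] [MeasurableSpace Ω] {Pr : Measure Ω}
  {P0 : Measure 𝒳} {Θ : Set (E p)} {θ0 : E p} {T : Fin m → 𝒳 → E p} {ψ : Fin m → E p → ℝ}
  {G : SimpleGraph (Fin m)} {A : Matrix (Fin m) (Fin m) ℝ} {X : ℕ → Fin m → Ω → 𝒳}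

lemma measurable_chi (hTm : ∀ i, Measurable (T i)) (hX : ∀ k i, Measurable (X k i)) (t : ℕ)
    (j : Fin m) : Measurable fun ω => chi A T (fun k i => X k i ω) t j := by
  have : ∀ k i, Measurable fun ω => T i (X k i ω) := fun k i => (hTm i).comp (hX k i)
  unfold chi
  fun_prop

/-- The coordinates of the score at `θ0` are of order `√t`. -/
lemma tendsto_measure_coord_ge [IsProbabilityMeasure Pr] (hA : IsCommunicationMatrix G A)
    (hT : ∀ i, IsTiltedFamily P0 Θ θ0 (T i) (ψ i)) (hX : ∀ k i, Measurable (X k i))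
    (hXlaw : ∀ k i, Measure.map (X k i) Pr = P0)
    (hXindep : iIndepFun (fun (ki : ℕ × Fin m) => X ki.1 ki.2) Pr) (j : Fin m) (a : Fin p)
    {δ : ℝ} (hδ : 0 < δ) :
    Tendsto (fun t : ℕ => Pr {ω | δ ≤ |((t : ℝ)⁻¹ • (chi A T (fun k i => X k i ω) t j
      - gradient (logPartition A ψ t j) θ0)) a|}) atTop (𝓝 0) := by
  have hP0 := (hT j).isProb
  have hTa : ∀ i, MemLp (fun x => T i x a) 2 P0 := fun i => by
    simpa [EuclideanSpace.inner_single_left] using (hT i).memLp_inner (EuclideanSpace.single a 1)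
  have hmp : ∀ k i, MeasurePreserving (X k i) Pr P0 := fun k i => ⟨hX k i, hXlaw k i⟩
  have hTX : ∀ k i, MemLp (fun ω => T i (X k i ω) a) 2 Pr := fun k i =>
    (hTa i).comp_measurePreserving (hmp k i)
  set v : ℝ := ∑ i, Var[fun x => T i x a; P0] with hv
  have hv0 : 0 ≤ v := Finset.sum_nonneg fun i _ => variance_nonneg _ _
  set w : ℕ → ℕ × Fin m → ℝ := fun t q => (A ^ (t - q.1)) j q.2 with hw
  set Z : ℕ → ℕ × Fin m → Ω → ℝ := fun t q ω => w t q * T q.2 (X q.1 q.2 ω) a with hZ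
  have hZm : ∀ t q, MemLp (Z t q) 2 Pr := fun t q => (hTX q.1 q.2).const_mul _
  set S : ℕ → Ω → ℝ := fun t => ∑ q ∈ Finset.Icc 1 t ×ˢ Finset.univ, Z t q with hS
  have hSm : ∀ t, MemLp (S t) 2 Pr := fun t => memLp_finsetSum' _ fun q _ => hZm t q
  have hSchi : ∀ t ω, S t ω = chi A T (fun k i => X k i ω) t j a := fun t ω => by
    simp [hS, chi_eq_sum_product, hZ, hw]
  have hSmean : ∀ t, Pr[S t] = gradient (logPartition A ψ t j) θ0 a := by
    intro t
    have e1 : Pr[S t] = ∑ q ∈ Finset.Icc 1 t ×ˢ Finset.univ, w t q * ∫ x, T q.2 x a ∂P0 := by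
      simp_rw [hS, Finset.sum_apply]
      rw [integral_finsetSum _ fun q _ => (hZm t q).integrable (by norm_num)]
      refine Finset.sum_congr rfl fun q _ => ?_
      rw [hZ, integral_const_mul]
      congr 1
      rw [← hXlaw q.1 q.2, integral_map (hX _ _).aemeasurable]
      have := (hT q.2).measurable_T
      fun_prop
    have e2 : ∀ i, (∫ x, T i x ∂P0) a = ∫ x, T i x a ∂P0 := fun i =>
      ((EuclideanSpace.proj (𝕜 := ℝ) a).integral_comp_comm
        ((hT i).memLp_two.integrable (by norm_num))).symm
    rw [(hasGradientAt_logPartition hT t j (hT j).mem).gradient, e1, Finset.sum_product,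
      Finset.sum_comm]
    simp only [fun i => (hT i).tiltMean_self, WithLp.ofLp_sum, Finset.sum_apply, PiLp.smul_apply,
      smul_eq_mul, e2, weight, hw, Finset.sum_mul]
  -- Squared weights are at most one, so the variance is O(t), against the t² in Chebyshev's
  -- inequality.
  have hSvar : ∀ t : ℕ, Var[S t; Pr] ≤ t * v := by
    intro t
    rw [hS, IndepFun.variance_sum (fun q _ => hZm t q)]
    · calc ∑ q ∈ Finset.Icc 1 t ×ˢ Finset.univ, Var[Z t q; Pr]
          ≤ ∑ q ∈ Finset.Icc 1 t ×ˢ Finset.univ, Var[fun x => T q.2 x a; P0] := by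
            refine Finset.sum_le_sum fun q _ => ?_
            have e1 : Var[fun ω => T q.2 (X q.1 q.2 ω) a; Pr] = Var[fun x => T q.2 x a; P0] := by
              have hm := (hT q.2).measurable_T
              have hm' : Measurable fun x => T q.2 x a := by fun_prop
              rw [← hXlaw q.1 q.2, variance_map hm'.aemeasurable (hX _ _).aemeasurable]
              rfl
            rw [hZ, variance_const_mul, e1]
            have h0 := hA.pow_nonneg (t - q.1) j q.2
            have h1 := hA.pow_le_one (t - q.1) j q.2
            exact mul_le_of_le_one_left (variance_nonneg _ _) (pow_le_one₀ h0 h1)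
        _ = t * v := by rw [Finset.sum_product]; simp [hv]
    · intro q _ q' _ hqq
      have hm : ∀ q : ℕ × Fin m, Measurable fun x => w t q * T q.2 x a := fun q => by
        have := (hT q.2).measurable_T
        fun_prop
      exact (hXindep.indepFun hqq).comp (hm q) (hm q')
  have hbound : ∀ t : ℕ, 1 ≤ t → Pr {ω | δ ≤ |((t : ℝ)⁻¹ • (chi A T (fun k i => X k i ω) t j
      - gradient (logPartition A ψ t j) θ0)) a|} ≤ ENNReal.ofReal (v / δ ^ 2 * (t : ℝ)⁻¹) := by
    intro t ht
    have ht0 : (0 : ℝ) < t := by exact_mod_cast ht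
    have hsub : {ω | δ ≤ |((t : ℝ)⁻¹ • (chi A T (fun k i => X k i ω) t j
        - gradient (logPartition A ψ t j) θ0)) a|} ⊆ {ω | δ * t ≤ |S t ω - Pr[S t]|} := by
      intro ω hω
      simp only [Set.mem_ofPred_eq, PiLp.smul_apply, PiLp.sub_apply, smul_eq_mul, abs_mul, abs_inv,
        Nat.abs_cast] at hω ⊢
      rw [hSmean, hSchi]
      rwa [← div_eq_inv_mul, le_div_iff₀ ht0] at hω
    refine (measure_mono hsub).trans ((meas_ge_le_variance_div_sq (hSm t) (by positivity)).trans
      (ENNReal.ofReal_le_ofReal ?_))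
    rw [div_le_iff₀ (by positivity)]
    refine (hSvar t).trans (le_of_eq ?_)
    field_simp
  have hlim : Tendsto (fun t : ℕ => ENNReal.ofReal (v / δ ^ 2 * (t : ℝ)⁻¹)) atTop (𝓝 0) := by
    have h1 : Tendsto (fun t : ℕ => v / δ ^ 2 * (t : ℝ)⁻¹) atTop (𝓝 (v / δ ^ 2 * 0)) :=
      (tendsto_inv_atTop_zero.comp tendsto_natCast_atTop_atTop).const_mul _
    simpa [Function.comp_def] using (ENNReal.continuous_ofReal.tendsto _).comp h1
  exact tendsto_of_tendsto_of_tendsto_of_le_of_le' tendsto_const_nhds hlim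
    (Eventually.of_forall fun _ => zero_le) ((eventually_ge_atTop 1).mono hbound)

/-- What holds eventually along the data filter has probability tending to one. -/
lemma tendsto_measure_not_of_eventually_dataFilter [IsProbabilityMeasure Pr]
    (hA : IsCommunicationMatrix G A)
    (hT : ∀ i, IsTiltedFamily P0 Θ θ0 (T i) (ψ i)) (hX : ∀ k i, Measurable (X k i))
    (hXlaw : ∀ k i, Measure.map (X k i) Pr = P0)
    (hXindep : iIndepFun (fun (ki : ℕ × Fin m) => X ki.1 ki.2) Pr) (j : Fin m)
    {R : ℕ × E p → Prop} (hR : ∀ᶠ z in dataFilter (fun t => logPartition A ψ t j) θ0, R z) :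
    Tendsto (fun t : ℕ => Pr {ω | ¬ R (t, chi A T (fun k i => X k i ω) t j)}) atTop (𝓝 0) := by
  rw [dataFilter, eventually_comap] at hR
  obtain ⟨pa, ha, pb, hb, hab⟩ := eventually_prod_iff.1 hR
  obtain ⟨δ, hδ, hδb⟩ := Metric.eventually_nhds_iff_ball.1 hb
  -- If every coordinate is below η then the squared norm is at most p η² < δ²; a union bound over
  -- coordinates finishes.
  set η := δ / (p + 1) with hη
  have hη0 : 0 < η := by positivity
  have hsum : Tendsto (fun t : ℕ => ∑ a : Fin p, Pr {ω | η ≤ |((t : ℝ)⁻¹ •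
      (chi A T (fun k i => X k i ω) t j - gradient (logPartition A ψ t j) θ0)) a|})
      atTop (𝓝 0) := by
    have := tendsto_finsetSum (Finset.univ : Finset (Fin p)) fun a _ =>
      tendsto_measure_coord_ge hA hT hX hXlaw hXindep j a hη0
    simpa using this
  refine tendsto_of_tendsto_of_tendsto_of_le_of_le' tendsto_const_nhds hsum
    (Eventually.of_forall fun _ => zero_le) ?_
  filter_upwards [ha] with t ht
  refine (measure_mono fun ω hω => ?_).trans (measure_iUnion_fintype_le Pr _)
  by_contra hcon
  simp only [Set.mem_iUnion, Set.mem_ofPred_eq, not_exists, not_le] at hcon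
  refine hω (hab ht (hδb _ ?_) _ rfl)
  rw [mem_ball_zero_iff]
  refine lt_of_pow_lt_pow_left₀ 2 hδ.le ?_
  rw [EuclideanSpace.norm_sq_eq]
  calc _ ≤ ∑ _a : Fin p, η ^ 2 := Finset.sum_le_sum fun a _ => by
        rw [Real.norm_eq_abs]
        exact pow_le_pow_left₀ (abs_nonneg _) (hcon a).le 2
    _ = p * η ^ 2 := by simp
    _ < δ ^ 2 := by
        rw [hη, div_pow, mul_div_assoc', div_lt_iff₀ (by positivity)]
        have : (0 : ℝ) ≤ p := Nat.cast_nonneg p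
        nlinarith [mul_pos (sq_pos_of_pos hδ) (show (0 : ℝ) < (p + 1) ^ 2 - p by nlinarith)]

/-- The expected likelihood ratio with fractional powers is at most one. -/
lemma lintegral_exp_le_one (hA : IsCommunicationMatrix G A)
    (hT : ∀ i, IsTiltedFamily P0 Θ θ0 (T i) (ψ i)) (hX : ∀ k i, Measurable (X k i))
    (hXlaw : ∀ k i, Measure.map (X k i) Pr = P0)
    (hXindep : iIndepFun (fun (ki : ℕ × Fin m) => X ki.1 ki.2) Pr) (t : ℕ) (j : Fin m)
    {θ : E p} (hθ : θ ∈ Θ) :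
    ∫⁻ ω, ENNReal.ofReal (Real.exp (⟪θ - θ0, chi A T (fun k i => X k i ω) t j⟫
      - (logPartition A ψ t j θ - logPartition A ψ t j θ0))) ∂Pr ≤ 1 := by
  have hP0 := (hT j).isProb
  set y : ℕ × Fin m → 𝒳 → ℝ := fun q x =>
    (A ^ (t - q.1)) j q.2 * (⟪θ - θ0, T q.2 x⟫ - (ψ q.2 θ - ψ q.2 θ0)) with hy
  have hym : ∀ q, Measurable (y q) := fun q => by
    have := (hT q.2).measurable_T
    fun_prop
  have e1 : ∀ ω, ENNReal.ofReal (Real.exp (⟪θ - θ0, chi A T (fun k i => X k i ω) t j⟫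
      - (logPartition A ψ t j θ - logPartition A ψ t j θ0)))
      = ∏ q ∈ Finset.Icc 1 t ×ˢ Finset.univ,
        ENNReal.ofReal (Real.exp (y q (X q.1 q.2 ω))) := by
    intro ω
    rw [← ENNReal.ofReal_prod_of_nonneg fun _ _ => Real.exp_nonneg _, ← Real.exp_sum]
    congr 2
    simp_rw [chi_eq_sum_product, logPartition, ← Finset.sum_product' (Finset.Icc 1 t) Finset.univ
      (fun k i => (A ^ (t - k)) j i * ψ i _), inner_sum, ← Finset.sum_sub_distrib, hy,
      inner_smul_right]
    refine Finset.sum_congr rfl fun q _ => ?_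
    ring
  simp_rw [e1]
  rw [lintegral_prod_eq_prod_lintegral_of_indepFun _
    (fun q ω => ENNReal.ofReal (Real.exp (y q (X q.1 q.2 ω))))]
  · refine Finset.prod_le_one' fun q _ => ?_
    have h0 := hA.pow_nonneg (t - q.1) j q.2
    have h1 := hA.pow_le_one (t - q.1) j q.2
    set w := (A ^ (t - q.1)) j q.2 with hw
    have hm := (hT q.2).measurable_T
    have e2 : ∫⁻ ω, ENNReal.ofReal (Real.exp (y q (X q.1 q.2 ω))) ∂Pr
        = ∫⁻ x, ENNReal.ofReal (Real.exp (y q x)) ∂P0 := by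
      have hyq := hym q
      rw [← hXlaw q.1 q.2, lintegral_map (by fun_prop) (hX _ _)]
    rw [e2]
    set s := ψ q.2 θ - ψ q.2 θ0 with hs
    -- Convexity gives exp(wz) ≤ w exp z + (1 - w) for weights w in [0, 1], and the likelihood ratio
    -- exp z has mean one, so each factor has mean at most one.
    have hconv : ∀ x, Real.exp (y q x) ≤ w * (Real.exp (-s) * Real.exp ⟪θ - θ0, T q.2 x⟫)
        + (1 - w) := by
      intro x
      have := convexOn_exp.2 (Set.mem_univ (⟪θ - θ0, T q.2 x⟫ - s)) (Set.mem_univ 0) h0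
        (sub_nonneg.2 h1) (by ring)
      simp only [smul_eq_mul, mul_zero, add_zero, Real.exp_zero, mul_one] at this
      rw [← Real.exp_add, neg_add_eq_sub]
      exact this
    have hI : Integrable (fun x => w * (Real.exp (-s) * Real.exp ⟪θ - θ0, T q.2 x⟫) + (1 - w)) P0 :=
      ((((hT q.2).integrable θ hθ).const_mul _).const_mul _).add (integrable_const _)
    refine (lintegral_mono fun x => ENNReal.ofReal_le_ofReal (hconv x)).trans ?_
    rw [← ofReal_integral_eq_lintegral_ofReal hI (ae_of_all _ fun x =>
      (Real.exp_nonneg _).trans (hconv x)), integral_add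
      ((((hT q.2).integrable θ hθ).const_mul _).const_mul _) (integrable_const _),
      integral_const_mul, integral_const_mul, (hT q.2).integral θ hθ, ← Real.exp_add]
    simp [hs]
  · exact hXindep.comp (fun q x => ENNReal.ofReal (Real.exp (y q x))) fun q => by
      have := hym q
      fun_prop
  · intro q
    have h1 := hym q
    have h2 := hX q.1 q.2
    exact (Real.measurable_exp.comp (h1.comp h2)).ennreal_ofReal

/-- Almost surely the posterior can be normalized. -/
lemma ae_lintegral_posteriorKernel_ne_top [IsProbabilityMeasure Pr]
    (hA : IsCommunicationMatrix G A)
    (hT : ∀ i, IsTiltedFamily P0 Θ θ0 (T i) (ψ i)) (hX : ∀ k i, Measurable (X k i))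
    (hXlaw : ∀ k i, Measure.map (X k i) Pr = P0)
    (hXindep : iIndepFun (fun (ki : ℕ × Fin m) => X ki.1 ki.2) Pr) (t : ℕ) (j : Fin m)
    {ρ : E p → ℝ} (hρ : ∀ θ, 0 < ρ θ) (hρm : AEMeasurable ρ (volume.restrict Θ))
    (hρi : ∫⁻ θ in Θ, ENNReal.ofReal (ρ θ) ≠ ∞) :
    ∀ᵐ ω ∂Pr, ∫⁻ θ, ENNReal.ofReal (posteriorKernel Θ ρ (logPartition A ψ t j)
      (chi A T (fun k i => X k i ω) t j) θ0 θ) ≠ ∞ := by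
  have hΘ := (hT j).isOpen
  set B := logPartition A ψ t j with hB
  set ν := (volume.restrict Θ).withDensity fun θ => ENNReal.ofReal (ρ θ) with hν
  have hνfin : IsFiniteMeasure ν := isFiniteMeasure_withDensity hρi
  have hac : ν ≪ volume.restrict Θ := withDensity_absolutelyContinuous _ _
  have hBc : ContinuousOn B Θ := fun θ hθ =>
    (hasGradientAt_logPartition hT t j hθ).continuousAt.continuousWithinAt
  have hBm : AEMeasurable B ν := (hBc.aemeasurable hΘ.measurableSet).mono_ac hac
  have hχ : Measurable fun ω => chi A T (fun k i => X k i ω) t j :=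
    measurable_chi (fun i => (hT i).measurable_T) hX t j
  set L : Ω → E p → ℝ≥0∞ := fun ω θ => ENNReal.ofReal (Real.exp
    (⟪θ - θ0, chi A T (fun k i => X k i ω) t j⟫ - (B θ - B θ0))) with hL
  have hLm : AEMeasurable (Function.uncurry L) (Pr.prod ν) := by
    have h1 : AEMeasurable (fun q : Ω × E p => B q.2) (Pr.prod ν) := hBm.comp_snd
    have h2 : Measurable fun q : Ω × E p => ⟪q.2 - θ0, chi A T (fun k i => X k i q.1) t j⟫ :=
      (measurable_snd.sub_const θ0).inner (hχ.comp measurable_fst)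
    exact (Real.measurable_exp.comp_aemeasurable
      (h2.aemeasurable.sub (h1.sub_const _))).ennreal_ofReal
  have hsec : ∀ ω, ∫⁻ θ, ENNReal.ofReal (posteriorKernel Θ ρ B
      (chi A T (fun k i => X k i ω) t j) θ0 θ) = ∫⁻ θ, L ω θ ∂ν := by
    intro ω
    have hm : AEMeasurable (L ω) (volume.restrict Θ) := by
      have h1 : AEMeasurable B (volume.restrict Θ) := hBc.aemeasurable hΘ.measurableSet
      have h2 : Measurable fun θ : E p => ⟪θ - θ0, chi A T (fun k i => X k i ω) t j⟫ := by fun_prop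
      exact (Real.measurable_exp.comp_aemeasurable
        (h2.aemeasurable.sub (h1.sub_const _))).ennreal_ofReal
    rw [hν, lintegral_withDensity_eq_lintegral_mul₀ hρm.ennreal_ofReal hm,
      ← lintegral_indicator hΘ.measurableSet]
    refine lintegral_congr fun θ => ?_
    by_cases hθ : θ ∈ Θ
    · rw [posteriorKernel, Set.indicator_of_mem hθ, Set.indicator_of_mem hθ, Pi.mul_apply,
        ENNReal.ofReal_mul (hρ θ).le]
    · simp [posteriorKernel, hθ]
  -- By Tonelli the expected normalizing constant is at most the mass of ρ on Θ; a finite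
  -- expectation makes it almost surely finite.
  have htot : ∫⁻ ω, ∫⁻ θ, L ω θ ∂ν ∂Pr ≠ ∞ := by
    rw [lintegral_lintegral_swap hLm]
    have hae : ∀ᵐ θ ∂ν, ∫⁻ ω, L ω θ ∂Pr ≤ 1 :=
      hac.ae_le ((ae_restrict_mem hΘ.measurableSet).mono fun θ hθ =>
        lintegral_exp_le_one hA hT hX hXlaw hXindep t j hθ)
    refine ((lintegral_mono_ae hae).trans_lt ?_).ne
    rw [lintegral_one]
    exact measure_lt_top _ _
  have hLm' : AEMeasurable (fun ω => ∫⁻ θ, L ω θ ∂ν) Pr := hLm.lintegral_prod_right'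
  filter_upwards [ae_lt_top' hLm' htot] with ω hω
  rw [hsec]
  exact hω.ne

lemma lintegral_posteriorKernel_ne_zero (hΘ : IsOpen Θ) (hθ0 : θ0 ∈ Θ) {ρ f : E p → ℝ}
    (hρ : ∀ θ, 0 < ρ θ) (hρm : AEMeasurable ρ (volume.restrict Θ)) (hf : ContinuousOn f Θ)
    (χ c : E p) :
    ∫⁻ θ, ENNReal.ofReal (posteriorKernel Θ ρ f χ c θ) ≠ 0 := by
  rw [ne_eq, lintegral_eq_zero_iff' (aemeasurable_posteriorKernel hΘ hρm hf χ c).ennreal_ofReal]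
  intro h0
  have hpos := hΘ.measure_pos volume ⟨θ0, hθ0⟩
  refine hpos.ne' (measure_mono_null (fun θ hθ => ?_) h0)
  have : 0 < posteriorKernel Θ ρ f χ c θ := by
    rw [posteriorKernel, Set.indicator_of_mem hθ]
    exact mul_pos (hρ θ) (Real.exp_pos _)
  simpa using this

end sampling

lemma gaussianDensity_inv {p : ℕ} {V : Matrix (Fin p) (Fin p) ℝ} (hV : V.PosDef) (y : E p) :
    gaussianDensity V⁻¹ y
      = Real.exp (-(quadForm V y / 2)) / √((2 * Real.pi) ^ p * (V⁻¹).det) := by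
  rw [gaussianDensity, Matrix.nonsing_inv_nonsing_inv _ (by simpa using hV.det_pos.ne'), quadForm]
  congr 2
  ring

lemma pos_of_isProbabilityMeasure_efPrior {p : ℕ} {Θ : Set (E p)} {g : ℝ} {u : E p}
    {ψ0 : E p → ℝ} (hprior : IsProbabilityMeasure (efPrior Θ g u ψ0)) : 0 < g := by
  by_contra hg
  have h1 := hprior.measure_univ
  have h0 : ∀ θ, ENNReal.ofReal (g * Real.exp (⟪θ, u⟫ - ψ0 θ)) = 0 := fun θ =>
    ENNReal.ofReal_of_nonpos (mul_nonpos_of_nonpos_of_nonneg (not_lt.1 hg) (Real.exp_nonneg _))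
  rw [efPrior, withDensity_apply _ MeasurableSet.univ] at h1
  simp [h0] at h1

lemma lintegral_exp_ne_top_of_isProbabilityMeasure_efPrior {p : ℕ} {Θ : Set (E p)} {g : ℝ}
    {u : E p} {ψ0 : E p → ℝ} (hprior : IsProbabilityMeasure (efPrior Θ g u ψ0)) :
    ∫⁻ θ in Θ, ENNReal.ofReal (Real.exp (⟪θ, u⟫ - ψ0 θ)) ≠ ∞ := by
  have hg := pos_of_isProbabilityMeasure_efPrior hprior
  have h1 := hprior.measure_univ
  rw [efPrior, withDensity_apply _ MeasurableSet.univ, setLIntegral_univ] at h1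
  simp_rw [ENNReal.ofReal_mul hg.le] at h1
  rw [lintegral_const_mul' _ _ ENNReal.ofReal_ne_top] at h1
  intro htop
  rw [htop, ENNReal.mul_top (by simpa using hg)] at h1
  exact ENNReal.top_ne_one h1

end DistBayes

end

/-! ### The distributed Bernstein–von Mises theorem -/

theorem proposition2 {p m : ℕ} {𝒳 Ω : Type*} [MeasurableSpace 𝒳] [MeasurableSpace Ω]
    -- the probability space carrying the data, and the true distribution of an observation
    (Pr : Measure Ω) [IsProbabilityMeasure Pr] (P0 : Measure 𝒳)
    -- the communication network
    (G : SimpleGraph (Fin m)) (A : Matrix (Fin m) (Fin m) ℝ)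
    (hA : DistBayes.IsCommunicationMatrix G A)
    -- the private models: full-rank canonical exponential families on an open set `Θ`
    (Θ : Set (DistBayes.E p)) (hΘ : IsOpen Θ)
    (μ : Measure 𝒳) (h : 𝒳 → ℝ) (T : Fin m → 𝒳 → DistBayes.E p)
    (ψ : Fin m → DistBayes.E p → ℝ)
    (hfam : ∀ i, DistBayes.IsCanonicalExpFamily μ Θ h (T i) (ψ i))
    (hrank : ∀ i, DistBayes.IsFullRank μ Θ h (T i) (ψ i))
    -- well-specification
    (θ0 : DistBayes.E p) (hθ0 : θ0 ∈ Θ)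
    (hwell : ∀ i, P0 = DistBayes.efMeasure μ h (T i) (ψ i) θ0)
    -- integrability of the log-densities
    (hlog : ∀ i, ∀ θ ∈ Θ,
      Integrable (fun x => Real.log (DistBayes.efDensity h (T i) (ψ i) θ x)) P0)
    -- the exponential-family prior
    (g : ℝ) (u : DistBayes.E p) (ψ0 : DistBayes.E p → ℝ)
    (hψ0 : AEMeasurable ψ0 (volume.restrict Θ)) (hψ0_cont : ContinuousAt ψ0 θ0)
    (hprior : IsProbabilityMeasure (DistBayes.efPrior Θ g u ψ0))
    -- the data: `X k i` is the observation of agent `i` at time `k`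
    (X : ℕ → Fin m → Ω → 𝒳) (hX : ∀ k i, Measurable (X k i))
    (hXlaw : ∀ k i, Measure.map (X k i) Pr = P0)
    (hXindep : iIndepFun (fun (ki : ℕ × Fin m) => X ki.1 ki.2) Pr)
    (j : Fin m) :
    -- the limiting covariance matrix makes sense
    (DistBayes.avgCov P0 T).PosDef ∧
    -- the gradient of the log-partition function is one-to-one on `Θ`, and the estimator is
    -- well defined with probability tending to one
    (∀ t : ℕ, 1 ≤ t → Set.InjOn (gradient (DistBayes.logPartition A ψ t j)) Θ) ∧
    Tendsto (fun t : ℕ => Pr {ω | DistBayes.chi A T (fun k i => X k i ω) t j ∉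
      gradient (DistBayes.logPartition A ψ t j) '' Θ}) atTop (𝓝 0) ∧
    -- the distributed Bayes posterior is a probability measure
    (∀ᵐ ω ∂Pr, ∀ t : ℕ, 1 ≤ t → IsProbabilityMeasure
      (DistBayes.posterior A (fun i => DistBayes.efDensity h (T i) (ψ i))
        (DistBayes.efPrior Θ g u ψ0) (fun k i => X k i ω) t j)) ∧
    -- convergence in probability to zero of the `L¹` distance of the densities
    ∀ ε : ℝ≥0∞, 0 < ε → Tendsto (fun t : ℕ => Pr {ω | ε ≤
      ∫⁻ y, ENNReal.ofReal |(DistBayes.rescaledDensity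
          (DistBayes.posterior A (fun i => DistBayes.efDensity h (T i) (ψ i))
            (DistBayes.efPrior Θ g u ψ0) (fun k i => X k i ω) t j)
          (DistBayes.estimator Θ A T ψ (fun k i => X k i ω) t j) t y).toReal -
        DistBayes.gaussianDensity (DistBayes.avgCov P0 T)⁻¹ y|}) atTop (𝓝 0) := by
  have hT : ∀ i, DistBayes.IsTiltedFamily P0 Θ θ0 (T i) (ψ i) := fun i => by
    rw [hwell i]
    exact (hfam i).isTiltedFamily (hrank i) hΘ hθ0
  have hV := DistBayes.posDef_avgCov hT j
  have hLQ := DistBayes.isLocallyQuadratic_logPartition hA hT j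
  have hg := DistBayes.pos_of_isProbabilityMeasure_efPrior hprior
  have hρi := DistBayes.lintegral_exp_ne_top_of_isProbabilityMeasure_efPrior hprior
  set ρ : DistBayes.E p → ℝ := fun θ => Real.exp (inner ℝ θ u - ψ0 θ) with hρ_def
  have hρ : ∀ θ, 0 < ρ θ := fun θ => Real.exp_pos _
  have hρm : AEMeasurable ρ (volume.restrict Θ) := by
    have : AEMeasurable (fun θ : DistBayes.E p => inner ℝ θ u) (volume.restrict Θ) := by fun_prop
    exact Real.measurable_exp.comp_aemeasurable (this.sub hψ0)
  have hρc : ContinuousAt ρ θ0 := by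
    have : ContinuousAt (fun θ : DistBayes.E p => inner ℝ θ u) θ0 := by fun_prop
    exact (this.sub hψ0_cont).rexp
  have hpos : ∀ᵐ ω ∂Pr, ∀ k i, 0 < h (X k i ω) := by
    rw [ae_all_iff]
    intro k
    rw [ae_all_iff]
    intro i
    have h1 : ∀ᵐ x ∂P0, 0 < h x := by
      rw [hwell i]
      exact (hfam i).ae_pos θ0
    rw [← hXlaw k i] at h1
    exact ae_of_ae_map (hX k i).aemeasurable h1
  refine ⟨hV, fun t ht => hLQ.injOn_gradient ht, ?_, ?_, ?_⟩
  · exact DistBayes.tendsto_measure_not_of_eventually_dataFilter hA hT hX hXlaw hXindep j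
      hLQ.eventually_mem_image
  -- Centred at θ0, the kernel is ρ times a likelihood ratio with expectation at most one.
  · have hfin : ∀ᵐ ω ∂Pr, ∀ t : ℕ, ∫⁻ θ, ENNReal.ofReal (DistBayes.posteriorKernel Θ ρ
        (DistBayes.logPartition A ψ t j) (DistBayes.chi A T (fun k i => X k i ω) t j) θ0 θ) ≠ ∞ :=
      ae_all_iff.2 fun t =>
        DistBayes.ae_lintegral_posteriorKernel_ne_top hA hT hX hXlaw hXindep t j hρ hρm hρi
    filter_upwards [hpos, hfin] with ω hω hωfin t ht
    rw [DistBayes.posterior_eq hA hω ht j hΘ hg hψ0 (hLQ.continuousOn t) θ0]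
    refine ⟨?_⟩
    rw [Measure.smul_apply, withDensity_apply _ MeasurableSet.univ, setLIntegral_univ, smul_eq_mul]
    exact ENNReal.inv_mul_cancel (DistBayes.lintegral_posteriorKernel_ne_zero hΘ hθ0 hρ hρm
      (hLQ.continuousOn t) _ _) (hωfin t)
  · intro ε hε
    set V := DistBayes.avgCov P0 T with hV_def
    set n : ℝ := ρ θ0 * √((2 * Real.pi) ^ p * (V⁻¹).det) with hn_def
    have hn : 0 < n := by
      have := hV.inv.det_pos
      have := hρ θ0
      positivity
    set φ : DistBayes.E p → ℝ := fun y => ρ θ0 * Real.exp (-(DistBayes.quadForm V y / 2)) with hφ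
    have hφ0 : ∀ y, 0 ≤ φ y := fun y => mul_nonneg (hρ θ0).le (Real.exp_nonneg _)
    have hφm : AEMeasurable φ volume := by
      have := DistBayes.continuous_quadForm V
      exact Measurable.aemeasurable (by fun_prop)
    have hφn : ∫⁻ y, ENNReal.ofReal (φ y) = ENNReal.ofReal n := by
      simp_rw [hφ, ENNReal.ofReal_mul (hρ θ0).le]
      rw [lintegral_const_mul' _ _ ENNReal.ofReal_ne_top, DistBayes.lintegral_exp_neg_quadForm hV,
        hn_def, ENNReal.ofReal_mul (hρ θ0).le]
    have hD := hLQ.tendsto_lintegral_posteriorKernel hρ hρm hρc hρi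
    have hn' : 0 < ENNReal.ofReal n := by simpa using hn
    have hD' := ENNReal.Tendsto.const_mul (a := ENNReal.ofReal (2 / n)) hD
      (Or.inr ENNReal.ofReal_ne_top)
    rw [mul_zero] at hD'
    -- The kernel distance depends on the data only through (t, χ), so closeness is a property along
    -- `dataFilter` and the deterministic limit becomes convergence in probability.
    have hgood := ((DistBayes.tendsto_fst_dataFilter (fun t => DistBayes.logPartition A ψ t j)
      θ0).eventually (eventually_ge_atTop 1)).and
      ((hD.eventually (gt_mem_nhds hn')).and (hD'.eventually (gt_mem_nhds hε)))
    refine tendsto_of_tendsto_of_tendsto_of_le_of_le tendsto_const_nhds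
      (DistBayes.tendsto_measure_not_of_eventually_dataFilter hA hT hX hXlaw hXindep j hgood)
      (fun _ => zero_le) fun t => ?_
    -- The inclusion of events needs h positive at all observations, hence holds only almost surely.
    refine measure_mono_ae ?_
    filter_upwards [hpos] with ω hω hle hgd
    obtain ⟨ht, hclose, hsmall⟩ := hgd
    refine absurd hle (not_le.2 (lt_of_le_of_lt ?_ hsmall))
    set χ := DistBayes.chi A T (fun k i => X k i ω) t j with hχ
    set c := DistBayes.estimator Θ A T ψ (fun k i => X k i ω) t j with hc
    have hs : 0 < (√t : ℝ)⁻¹ := by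
      have : (0 : ℝ) < t := by exact_mod_cast ht
      positivity
    have hKm := DistBayes.aemeasurable_posteriorKernel hΘ hρm (hLQ.continuousOn t) χ c
    obtain ⟨⟨hN0, -⟩, hbound⟩ := DistBayes.lintegral_abs_normalized_sub_le
      (DistBayes.aemeasurable_comp_add_smul c hs hKm) hφm
      (fun y => DistBayes.posteriorKernel_nonneg hρ χ c _) hφ0 hn hφn hclose
    refine le_trans (le_of_eq ?_) hbound
    rw [DistBayes.posterior_eq hA hω ht j hΘ hg hψ0 (hLQ.continuousOn t) c]
    refine lintegral_congr_ae ?_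
    filter_upwards [DistBayes.rescaledDensity_withDensity hKm.ennreal_ofReal c ht hN0] with y hy
    rw [hy, DistBayes.gaussianDensity_inv hV, hφ, hn_def,
      mul_div_mul_left _ _ (hρ θ0).ne']
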